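/- Let $n\ge 2$ (equivalently, $2s<n$ for all $s$ considered below), let $\Omega\subset\mathbb R^n$ be a bounded Lipschitz domain, and let $dQ$ denote the surface measure on $\partial\Omega$. For $0<\alpha<1$ let $H^{\alpha}(\partial\Omega)$ be the space of real-valued $f\in L^2(\partial\Omega)$ with $$\|f\|_{H^\alpha(\partial\Omega)}^2=\int_{\partial\Omega}|f(P)|^2\,dP+\int_{\partial\Omega}\int_{\partial\Omega}\frac{|f(P)-f(Q)|^2}{|P-Q|^{n-1+2\alpha}}\,dP\,dQ<\infty ,$$ and let $H^{-\alpha}(\partial\Omega)=(H^{\alpha}(\partial\Omega))^*$ be its dual space, with the dual norm and the duality pairing $\langle\cdot,\cdot\rangle$. Let $\frac12<s<1$ and let $\Gamma_{2s}(x)=c\,|x|^{-(n-2s)}$ be the Riesz kernel of order $2s$, where $c=c(n,s)$ is its normalising constant (its value plays no role: the statement holds for every real $c$). Then for every $x\in\mathbb R^n\setminus\partial\Omega$ the function $\Gamma_{2s}(x-\cdot)$ belongs to $H^{s-\frac12}(\partial\Omega)$, so that for $\phi\in H^{-s+\frac12}(\partial\Omega)$ the layer potential $$\mathcal S_s\phi(x)=\langle\phi,\Gamma_{2s}(x-\cdot)\rangle,\qquad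 x\in\mathbb R^n\setminus\partial\Omega,$$ is defined. Moreover, for each such $\phi$ the function $\mathcal S_s\phi$ is locally integrable on $\mathbb R^n$; its restriction to the boundary $$S_s\phi(P)=(\mathcal S_s\phi)|_{\partial\Omega}(P)=\lim_{r\to0^+}\frac1{|B(P,r)|}\int_{B(P,r)}\mathcal S_s\phi(y)\,dy$$ exists for almost every $P\in\partial\Omega$ and belongs to $H^{s-\frac12}(\partial\Omega)$; and $$S_s:H^{-s+\frac12}(\partial\Omega)\to H^{s-\frac12}(\partial\Omega)$$ is a bounded linear operator. -/

import Mathlib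

open MeasureTheory Set Filter Topology
open scoped ENNReal NNReal RealInnerProductSpace

noncomputable section

/-- A bounded Lipschitz domain in `ℝⁿ`: a bounded, open, connected set which, near each of its
boundary points, is the strict epigraph of a Lipschitz function in suitable orthonormal
coordinates. Here `e` is the unit vector of the vertical direction, `⟪e, x⟫` is the height of `x`,
and `x - ⟪e, x⟫ • e` is the horizontal part of `x`. -/
structure BoundedLipschitzDomain (n : ℕ) where
  carrier : Set (EuclideanSpace ℝ (Fin n))
  isOpen : IsOpen carrier
  isConnected : IsConnected carrier
  isBounded : Bornology.IsBounded carrier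
  lipschitz : ∀ P ∈ frontier carrier, ∃ r > (0 : ℝ), ∃ e : EuclideanSpace ℝ (Fin n), ‖e‖ = 1 ∧
    ∃ (K : ℝ≥0) (g : EuclideanSpace ℝ (Fin n) → ℝ), LipschitzWith K g ∧
      carrier ∩ Metric.ball P r = {x | g (x - ⟪e, x⟫ • e) < ⟪e, x⟫} ∩ Metric.ball P r

namespace BoundedLipschitzDomain

variable {n : ℕ}

/-- The boundary `∂Ω`. -/
def boundary (Ω : BoundedLipschitzDomain n) : Set (EuclideanSpace ℝ (Fin n)) :=
  frontier Ω.carrier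

/-- The surface measure on `∂Ω`: the `(n-1)`-dimensional Hausdorff measure, in its Euclidean
normalisation, restricted to `∂Ω`. -/
def surfaceMeasure (Ω : BoundedLipschitzDomain n) : Measure (EuclideanSpace ℝ (Fin n)) :=
  (μHE[n - 1]).restrict Ω.boundary

theorem isCompact_boundary (Ω : BoundedLipschitzDomain n) : IsCompact Ω.boundary :=
  Metric.isCompact_of_isClosed_isBounded isClosed_frontier
    (Ω.isBounded.closure.subset frontier_subset_closure)

theorem boundary_inter_ball_subset_graph {Ω : BoundedLipschitzDomain n}
    {P e : EuclideanSpace ℝ (Fin n)} {r : ℝ} {K : ℝ≥0} {g : EuclideanSpace ℝ (Fin n) → ℝ}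
    (hg : LipschitzWith K g)
    (h : Ω.carrier ∩ Metric.ball P r = {x | g (x - ⟪e, x⟫ • e) < ⟪e, x⟫} ∩ Metric.ball P r) :
    Ω.boundary ∩ Metric.ball P r ⊆ {x | g (x - ⟪e, x⟫ • e) = ⟪e, x⟫} := by
  rintro x ⟨hx, hxr⟩
  have hc : Continuous fun x : EuclideanSpace ℝ (Fin n) => g (x - ⟪e, x⟫ • e) :=
    hg.continuous.comp (by fun_prop)
  have hc' : Continuous fun x : EuclideanSpace ℝ (Fin n) => ⟪e, x⟫ := by fun_prop
  rw [boundary, frontier, Ω.isOpen.interior_eq] at hx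
  apply le_antisymm
  · by_contra! hlt
    have hU : {y | ⟪e, y⟫ < g (y - ⟪e, y⟫ • e)} ∩ Metric.ball P r ∈ 𝓝 x :=
      inter_mem ((isOpen_lt hc' hc).mem_nhds hlt) (Metric.isOpen_ball.mem_nhds hxr)
    obtain ⟨y, hy, hyΩ⟩ := mem_closure_iff_nhds.1 hx.1 _ hU
    have : y ∈ {x | g (x - ⟪e, x⟫ • e) < ⟪e, x⟫} ∩ Metric.ball P r := h ▸ ⟨hyΩ, hy.2⟩
    exact lt_asymm (show g (y - ⟪e, y⟫ • e) < ⟪e, y⟫ from this.1) hy.1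
  · by_contra! hlt
    have : x ∈ Ω.carrier ∩ Metric.ball P r := h ▸ ⟨hlt, hxr⟩
    exact hx.2 this.1

/-- The surface measure of a bounded Lipschitz domain is finite. -/
instance isFiniteMeasure_surfaceMeasure (Ω : BoundedLipschitzDomain n) :
    IsFiniteMeasure Ω.surfaceMeasure := by
  refine ⟨?_⟩
  rw [surfaceMeasure, Measure.restrict_apply_univ]
  refine Ω.isCompact_boundary.measure_lt_top_of_nhdsWithin fun P hP => ?_
  obtain ⟨r, hr, e, he, K, g, hg, h⟩ := Ω.lipschitz P hP
  have hsub := boundary_inter_ball_subset_graph hg h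
  refine ⟨Ω.boundary ∩ Metric.ball P r,
    inter_mem_nhdsWithin _ (Metric.ball_mem_nhds P hr), ?_⟩
  have he0 : e ≠ 0 := by
    rintro rfl
    simp at he
  have hn : Module.finrank ℝ (ℝ ∙ e)ᗮ = n - 1 := by
    have h1 := (ℝ ∙ e).finrank_add_finrank_orthogonal
    rw [finrank_span_singleton he0, finrank_euclideanSpace_fin] at h1
    omega
  let G : (ℝ ∙ e)ᗮ → EuclideanSpace ℝ (Fin n) := fun y => y + g y • e
  have hG : LipschitzWith (1 + K) G := by
    refine LipschitzWith.add (LipschitzWith.subtype_val _) ?_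
    refine LipschitzWith.of_dist_le_mul fun y z => ?_
    rw [dist_eq_norm, ← sub_smul, norm_smul, he, mul_one, ← dist_eq_norm]
    exact hg.dist_le_mul y z
  have hsub2 : Ω.boundary ∩ Metric.ball P r ⊆ G '' Metric.closedBall 0 (‖P‖ + r) := by
    intro x hx
    have hxg := hsub hx
    have hmem : x - ⟪e, x⟫ • e ∈ (ℝ ∙ e)ᗮ := by
      rw [Submodule.mem_orthogonal_singleton_iff_inner_right, inner_sub_right, inner_smul_right,
        real_inner_self_eq_norm_sq, he]
      ring
    refine ⟨⟨_, hmem⟩, ?_, ?_⟩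
    · rw [mem_closedBall_zero_iff, Submodule.coe_norm]
      have hpy : ‖x - ⟪e, x⟫ • e‖ ^ 2 ≤ ‖x‖ ^ 2 := by
        have : ‖x - ⟪e, x⟫ • e‖ ^ 2 = ‖x‖ ^ 2 - ⟪e, x⟫ ^ 2 := by
          rw [norm_sub_sq_real, inner_smul_right, norm_smul, he, real_inner_comm, mul_one,
            Real.norm_eq_abs, sq_abs]
          ring
        nlinarith [sq_nonneg ⟪e, x⟫]
      have h1 : ‖x - ⟪e, x⟫ • e‖ ≤ ‖x‖ := le_of_sq_le_sq hpy (norm_nonneg _)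
      have h2 : dist x P < r := hx.2
      rw [dist_eq_norm] at h2
      have h3 := norm_le_norm_add_norm_sub' x P
      linarith
    · have : g (x - ⟪e, x⟫ • e) = ⟪e, x⟫ := hxg
      change x - ⟪e, x⟫ • e + g (x - ⟪e, x⟫ • e) • e = x
      rw [this]
      abel
  refine (measure_mono hsub2).trans_lt ?_
  rw [Measure.euclideanHausdorffMeasure_def, Measure.smul_apply, ENNReal.smul_def, smul_eq_mul]
  refine ENNReal.mul_lt_top ENNReal.coe_lt_top ?_
  refine (hG.hausdorffMeasure_image_le (Nat.cast_nonneg _) _).trans_lt ?_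
  refine ENNReal.mul_lt_top (ENNReal.rpow_lt_top_of_nonneg (Nat.cast_nonneg _)
    ENNReal.coe_ne_top) ?_
  rw [← hn]
  exact (isCompact_closedBall _ _).measure_lt_top

/-- The squared Gagliardo seminorm
`∫_{∂Ω} ∫_{∂Ω} |f(P) - f(Q)|² / |P - Q|^{n - 1 + 2α} dP dQ`. -/
def gagliardo (Ω : BoundedLipschitzDomain n) (α : ℝ) (f : EuclideanSpace ℝ (Fin n) → ℝ) : ℝ≥0∞ :=
  ∫⁻ P, ∫⁻ Q, ENNReal.ofReal (|f P - f Q| ^ 2 / ‖P - Q‖ ^ ((n : ℝ) - 1 + 2 * α))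
    ∂Ω.surfaceMeasure ∂Ω.surfaceMeasure

/-- `f|_{∂Ω}` belongs to `H^α(∂Ω)`. -/
def MemSobolev (Ω : BoundedLipschitzDomain n) (α : ℝ) (f : EuclideanSpace ℝ (Fin n) → ℝ) : Prop :=
  MemLp f 2 Ω.surfaceMeasure ∧ Ω.gagliardo α f < ∞

theorem gagliardo_congr (Ω : BoundedLipschitzDomain n) (α : ℝ)
    {f g : EuclideanSpace ℝ (Fin n) → ℝ} (h : f =ᵐ[Ω.surfaceMeasure] g) :
    Ω.gagliardo α f = Ω.gagliardo α g := by
  refine lintegral_congr_ae ?_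
  filter_upwards [h] with P hP
  refine lintegral_congr_ae ?_
  filter_upwards [h] with Q hQ
  rw [hP, hQ]

theorem MemSobolev.congr {Ω : BoundedLipschitzDomain n} {α : ℝ}
    {f g : EuclideanSpace ℝ (Fin n) → ℝ} (hf : Ω.MemSobolev α f)
    (h : f =ᵐ[Ω.surfaceMeasure] g) : Ω.MemSobolev α g :=
  ⟨(memLp_congr_ae h).1 hf.1, Ω.gagliardo_congr α h ▸ hf.2⟩

/-- The difference quotient whose `L²(∂Ω × ∂Ω)` norm is the Gagliardo seminorm. -/
def diffQuot (α : ℝ) (f : EuclideanSpace ℝ (Fin n) → ℝ)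
    (p : EuclideanSpace ℝ (Fin n) × EuclideanSpace ℝ (Fin n)) : ℝ :=
  (f p.1 - f p.2) / ‖p.1 - p.2‖ ^ (((n : ℝ) - 1 + 2 * α) / 2)

theorem aestronglyMeasurable_diffQuot (Ω : BoundedLipschitzDomain n) (α : ℝ)
    {f : EuclideanSpace ℝ (Fin n) → ℝ} (hf : AEStronglyMeasurable f Ω.surfaceMeasure) :
    AEStronglyMeasurable (diffQuot α f) (Ω.surfaceMeasure.prod Ω.surfaceMeasure) := by
  have h1 : AEMeasurable (fun p : EuclideanSpace ℝ (Fin n) × EuclideanSpace ℝ (Fin n) =>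
      f p.1 - f p.2) (Ω.surfaceMeasure.prod Ω.surfaceMeasure) :=
    (hf.comp_fst.sub hf.comp_snd).aemeasurable
  have h2 : Measurable (fun p : EuclideanSpace ℝ (Fin n) × EuclideanSpace ℝ (Fin n) =>
      ‖p.1 - p.2‖ ^ (((n : ℝ) - 1 + 2 * α) / 2)) := by fun_prop
  exact (h1.div h2.aemeasurable).aestronglyMeasurable

theorem gagliardo_eq (Ω : BoundedLipschitzDomain n) (α : ℝ)
    {f : EuclideanSpace ℝ (Fin n) → ℝ} (hf : AEStronglyMeasurable f Ω.surfaceMeasure) :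
    Ω.gagliardo α f =
      eLpNorm (diffQuot α f) 2 (Ω.surfaceMeasure.prod Ω.surfaceMeasure) ^ (2 : ℝ) := by
  have hm := Ω.aestronglyMeasurable_diffQuot α hf
  rw [eLpNorm_eq_lintegral_rpow_enorm_toReal (by simp) (by simp), ← ENNReal.rpow_mul]
  simp only [ENNReal.toReal_ofNat, one_div, inv_mul_cancel₀ (two_ne_zero' ℝ), ENNReal.rpow_one]
  rw [lintegral_prod _ (hm.enorm.pow_const _)]
  refine lintegral_congr fun P => lintegral_congr fun Q => ?_
  rw [← ofReal_norm, ENNReal.ofReal_rpow_of_nonneg (norm_nonneg _) zero_le_two]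
  congr 1
  rw [diffQuot, norm_div, Real.norm_eq_abs, Real.norm_of_nonneg (by positivity),
    Real.div_rpow (abs_nonneg _) (by positivity), ← Real.rpow_mul (norm_nonneg _)]
  norm_num

theorem memSobolev_iff (Ω : BoundedLipschitzDomain n) (α : ℝ)
    {f : EuclideanSpace ℝ (Fin n) → ℝ} :
    Ω.MemSobolev α f ↔ MemLp f 2 Ω.surfaceMeasure ∧
      MemLp (diffQuot α f) 2 (Ω.surfaceMeasure.prod Ω.surfaceMeasure) := by
  refine and_congr_right fun hf => ?_
  rw [Ω.gagliardo_eq α hf.1, MemLp, ENNReal.rpow_lt_top_iff_of_pos two_pos]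
  exact ⟨fun h => ⟨Ω.aestronglyMeasurable_diffQuot α hf.1, h⟩, fun h => h.2⟩

theorem diffQuot_add (α : ℝ) (f g : EuclideanSpace ℝ (Fin n) → ℝ) :
    diffQuot α (f + g) = diffQuot α f + diffQuot α g := by
  ext p
  simp only [diffQuot, Pi.add_apply]
  ring

theorem diffQuot_smul (α c : ℝ) (f : EuclideanSpace ℝ (Fin n) → ℝ) :
    diffQuot α (c • f) = c • diffQuot α f := by
  ext p
  simp only [diffQuot, Pi.smul_apply, smul_eq_mul]
  ring

theorem diffQuot_congr (Ω : BoundedLipschitzDomain n) (α : ℝ)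
    {f g : EuclideanSpace ℝ (Fin n) → ℝ} (h : f =ᵐ[Ω.surfaceMeasure] g) :
    diffQuot α f =ᵐ[Ω.surfaceMeasure.prod Ω.surfaceMeasure] diffQuot α g := by
  filter_upwards [Measure.quasiMeasurePreserving_fst.ae_eq_comp h,
    Measure.quasiMeasurePreserving_snd.ae_eq_comp h] with p h1 h2
  simp only [Function.comp_apply] at h1 h2
  rw [diffQuot, diffQuot, h1, h2]

/-- `H^α(∂Ω)` as a linear subspace of `L²(∂Ω)`. -/
def sobolevSubmodule (Ω : BoundedLipschitzDomain n) (α : ℝ) :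
    Submodule ℝ (Lp ℝ 2 Ω.surfaceMeasure) where
  carrier := {f | Ω.MemSobolev α f}
  add_mem' {f g} hf hg := by
    have hf' := (Ω.memSobolev_iff α).1 hf
    have hg' := (Ω.memSobolev_iff α).1 hg
    refine MemSobolev.congr ((Ω.memSobolev_iff α).2 ⟨hf'.1.add hg'.1, ?_⟩) (Lp.coeFn_add f g).symm
    rw [diffQuot_add]
    exact hf'.2.add hg'.2
  zero_mem' := by
    refine MemSobolev.congr (f := 0) ⟨MemLp.zero, ?_⟩ (Lp.coeFn_zero _ _ _).symm
    simp [gagliardo]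
  smul_mem' c f hf := by
    have hf' := (Ω.memSobolev_iff α).1 hf
    refine MemSobolev.congr ((Ω.memSobolev_iff α).2 ⟨hf'.1.const_smul c, ?_⟩)
      (Lp.coeFn_smul c f).symm
    rw [diffQuot_smul]
    exact hf'.2.const_smul c

/-- The Sobolev space `H^α(∂Ω)`; its norm is defined below (it is not the norm of `L²(∂Ω)`). -/
def Sobolev (Ω : BoundedLipschitzDomain n) (α : ℝ) : Type :=
  ↥(Ω.sobolevSubmodule α)

namespace Sobolev

variable {Ω : BoundedLipschitzDomain n} {α : ℝ}

instance : AddCommGroup (Ω.Sobolev α) := inferInstanceAs (AddCommGroup ↥(Ω.sobolevSubmodule α))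

instance : Module ℝ (Ω.Sobolev α) := inferInstanceAs (Module ℝ ↥(Ω.sobolevSubmodule α))

/-- The inclusion of `H^α(∂Ω)` in `L²(∂Ω)`. -/
def toL2 : Ω.Sobolev α →ₗ[ℝ] Lp ℝ 2 Ω.surfaceMeasure := (Ω.sobolevSubmodule α).subtype

/-- The element of `H^α(∂Ω)` given by a function `f`. -/
def mk (f : EuclideanSpace ℝ (Fin n) → ℝ) (hf : Ω.MemSobolev α f) : Ω.Sobolev α :=
  ⟨hf.1.toLp f, hf.congr hf.1.coeFn_toLp.symm⟩

theorem memSobolev (f : Ω.Sobolev α) : Ω.MemSobolev α (toL2 f) := f.2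

theorem toL2_injective : Function.Injective (toL2 (Ω := Ω) (α := α)) := Subtype.val_injective

/-- `‖f‖² = ∫_{∂Ω} |f|² + ∫_{∂Ω} ∫_{∂Ω} |f(P) - f(Q)|² / |P - Q|^{n - 1 + 2α} dP dQ`. -/
instance : Norm (Ω.Sobolev α) where
  norm f := √(∫ P, |toL2 f P| ^ 2 ∂Ω.surfaceMeasure + (Ω.gagliardo α (toL2 f)).toReal)

theorem norm_def (f : Ω.Sobolev α) :
    ‖f‖ = √(∫ P, |toL2 f P| ^ 2 ∂Ω.surfaceMeasure + (Ω.gagliardo α (toL2 f)).toReal) := rfl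

/-- The difference quotient as a linear map from `H^α(∂Ω)` to `L²(∂Ω × ∂Ω)`. -/
def diffQuotₗ : Ω.Sobolev α →ₗ[ℝ] Lp ℝ 2 (Ω.surfaceMeasure.prod Ω.surfaceMeasure) where
  toFun f := ((Ω.memSobolev_iff α).1 f.memSobolev).2.toLp
  map_add' f g := by
    rw [← MemLp.toLp_add]
    refine (MemLp.toLp_eq_toLp_iff _ _).2 ?_
    rw [← diffQuot_add]
    refine Ω.diffQuot_congr α ?_
    rw [map_add]
    exact Lp.coeFn_add _ _
  map_smul' c f := by
    rw [RingHom.id_apply, ← MemLp.toLp_const_smul]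
    refine (MemLp.toLp_eq_toLp_iff _ _).2 ?_
    rw [← diffQuot_smul]
    refine Ω.diffQuot_congr α ?_
    rw [map_smul]
    exact Lp.coeFn_smul _ _

theorem norm_eq (f : Ω.Sobolev α) :
    ‖f‖ = ‖WithLp.toLp 2 (toL2 f, diffQuotₗ f)‖ := by
  have h1 : ∫ P, |toL2 f P| ^ 2 ∂Ω.surfaceMeasure = ‖toL2 f‖ ^ 2 := by
    rw [← real_inner_self_eq_norm_sq, L2.inner_def]
    refine integral_congr_ae (Eventually.of_forall fun P => ?_)
    simp [sq]
  have h2 : (Ω.gagliardo α (toL2 f)).toReal = ‖diffQuotₗ f‖ ^ 2 := by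
    rw [Ω.gagliardo_eq α f.memSobolev.1.1, ← ENNReal.toReal_rpow]
    change _ = ‖((Ω.memSobolev_iff α).1 f.memSobolev).2.toLp‖ ^ 2
    rw [Lp.norm_toLp, Real.rpow_ofNat]
  rw [norm_def, h1, h2, WithLp.prod_norm_eq_of_L2]
  rfl

theorem normedSpaceCore : NormedSpace.Core ℝ (Ω.Sobolev α) where
  norm_nonneg _ := Real.sqrt_nonneg _
  norm_smul c f := by
    rw [norm_eq, norm_eq, ← norm_smul, ← WithLp.toLp_smul, map_smul, map_smul, Prod.smul_mk]
  norm_triangle f g := by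
    rw [norm_eq, norm_eq, norm_eq, map_add, map_add, ← Prod.mk_add_mk, WithLp.toLp_add]
    exact norm_add_le _ _
  norm_eq_zero_iff f := by
    rw [norm_eq, norm_eq_zero, WithLp.toLp_eq_zero, Prod.mk_eq_zero]
    refine ⟨fun h => toL2_injective (h.1.trans (map_zero _).symm), ?_⟩
    rintro rfl
    exact ⟨map_zero _, map_zero _⟩

instance : NormedAddCommGroup (Ω.Sobolev α) := NormedAddCommGroup.ofCore normedSpaceCore

instance : NormedSpace ℝ (Ω.Sobolev α) := NormedSpace.ofCore normedSpaceCore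

end Sobolev

/-- `H^{-α}(∂Ω)`: the dual space of `H^α(∂Ω)`, with the dual norm. -/
abbrev DualSobolev (Ω : BoundedLipschitzDomain n) (α : ℝ) : Type :=
  StrongDual ℝ (Ω.Sobolev α)

end BoundedLipschitzDomain

/-- The Riesz kernel `Γ_{2s}(x) = c |x|^{-(n - 2s)}` of order `2s` in `ℝⁿ`, with normalising
constant `c`. -/
def rieszKernel {n : ℕ} (c s : ℝ) (x : EuclideanSpace ℝ (Fin n)) : ℝ :=
  c * (1 / ‖x‖ ^ ((n : ℝ) - 2 * s))

namespace BoundedLipschitzDomain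

variable {n : ℕ}

open Classical in
/-- The layer potential `(𝒮_s φ)(x) = ⟨φ, Γ_{2s}(x - ·)⟩` of `φ ∈ H^{-α}(∂Ω)`, for `x ∉ ∂Ω`.
It is extended by `0` to the Lebesgue null set `∂Ω`. -/
def layerPotential (Ω : BoundedLipschitzDomain n) (c s : ℝ) {α : ℝ} (φ : Ω.DualSobolev α)
    (x : EuclideanSpace ℝ (Fin n)) : ℝ :=
  if h : x ∉ Ω.boundary ∧ Ω.MemSobolev α (fun Q => rieszKernel c s (x - Q)) then
    φ (Sobolev.mk (fun Q => rieszKernel c s (x - Q)) h.2)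
  else 0

/-- `f` is the restriction (trace) `u|_{∂Ω}` of a locally integrable function `u`, which need only
be given almost everywhere on `ℝⁿ`: for almost every `P ∈ ∂Ω`, `f(P)` is the limit, as `r → 0⁺`, of
the averages of `u` over the balls `B(P, r)`. -/
def IsRestriction (Ω : BoundedLipschitzDomain n) (u f : EuclideanSpace ℝ (Fin n) → ℝ) : Prop :=
  LocallyIntegrable u ∧ ∀ᵐ P ∂Ω.surfaceMeasure,
    Tendsto (fun r : ℝ => ⨍ y in Metric.ball P r, u y) (𝓝[>] 0) (𝓝 (f P))

end BoundedLipschitzDomain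

end

/-! ### Cauchy–Schwarz and power integrals on the half-line -/

section PowerIntegrals

/-! The operator factors as a multiple of `T T*` through a Hilbert space, so its boundedness reduces
to a single trace estimate.

Put `b = 2n - 2s` and let `tent P (z, r) = max 0 (1 - |z - P| / r)` on the half-space `r > 0` with
the measure `r ^ (-b - 1) dz dr`. Scaling and rotation invariance give `∫ tent P * tent x = C |x -
P| ^ (n - b)`, with `n - b = -(n - 2s)`; so the Riesz kernel is a pairing of tents
(`exists_integral_tent_mul_tent_eq`). If `P ∈ ∂Ω`, nothing is lost by integrating only over the
union of the cones with vertices on `∂Ω`. On that union `tent x` is square integrable for every `x ∉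
∂Ω`, because small scales near `x` have been removed (`lintegral_sq_tent_lt_top`).

Let `T g (P) = ∫ tent P * g`. It is bounded from `L²` of the cones to `H^{s - 1/2}(∂Ω)`
(`exists_coneTrace`), and the kernel with pole `x` is `(c / C) T (tent x)`. Hence it lies in `H^{s -
1/2}(∂Ω)`, and the layer potential of `φ` at `x` is `(c / C) ⟪T*φ, tent x⟫`, which is `c / C` times
the cone integral of `T*φ` at `x`. The same cone integral on `∂Ω` is `T T*φ`.

The trace estimate uses only the bound `m(B(x, r)) ≤ A r ^ d`. The difference of two tents is at
most `min 1 (|P - Q| / r)`, and a Schur test with power weights in the scale then bounds the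
Gagliardo integral (`exists_lintegral_coneAvg_le`). It works for a pair of measures of different
dimensions. With surface measure twice it gives the bound for `T`; with surface and Lebesgue measure
it shows that averages over balls `B(P, r)` converge to the cone integral at almost every `P ∈ ∂Ω`
(`ae_tendsto_average_coneIntegral`). -/

/-- Cauchy-Schwarz inequality, in a form where the factors are given by their squares. -/
theorem sq_lintegral_le_of_sq_le_mul {X : Type*} [MeasurableSpace X] {μ : Measure X}
    {F A B : X → ℝ≥0∞} (hA : Measurable A) (hB : Measurable B)
    (h : ∀ᵐ x ∂μ, F x ^ 2 ≤ A x * B x) :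
    (∫⁻ x, F x ∂μ) ^ 2 ≤ (∫⁻ x, A x ∂μ) * ∫⁻ x, B x ∂μ := by
  have h2 : ∀ z : ℝ≥0∞, (z ^ (1 / 2 : ℝ)) ^ (2 : ℝ) = z := fun z => by
    rw [← ENNReal.rpow_mul]; norm_num
  have h1 : ∫⁻ x, F x ∂μ ≤
      ∫⁻ x, ((fun x => A x ^ (1 / 2 : ℝ)) * fun x => B x ^ (1 / 2 : ℝ)) x ∂μ := by
    refine lintegral_mono_ae ?_
    filter_upwards [h] with x hx
    rw [Pi.mul_apply, ← ENNReal.mul_rpow_of_nonneg _ _ (by norm_num)]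
    calc F x = (F x ^ 2) ^ (1 / 2 : ℝ) := by
          rw [← ENNReal.rpow_natCast, ← ENNReal.rpow_mul]; norm_num
      _ ≤ _ := ENNReal.rpow_le_rpow hx (by norm_num)
  have h3 := h1.trans (ENNReal.lintegral_mul_le_Lp_mul_Lq μ Real.HolderConjugate.two_two
    (hA.pow_const _).aemeasurable (hB.pow_const _).aemeasurable)
  simp only [h2] at h3
  calc (∫⁻ x, F x ∂μ) ^ 2 ≤ _ := pow_le_pow_left' h3 2
    _ = _ := by
      rw [mul_pow, ← ENNReal.rpow_natCast, ← ENNReal.rpow_natCast, ← ENNReal.rpow_mul,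
        ← ENNReal.rpow_mul]
      norm_num

theorem lintegral_Ioc_rpow {a t : ℝ} (ha : -1 < a) (ht : 0 ≤ t) :
    ∫⁻ r in Ioc 0 t, ENNReal.ofReal (r ^ a) = ENNReal.ofReal (t ^ (a + 1) / (a + 1)) := by
  have hi := (intervalIntegrable_iff_integrableOn_Ioc_of_le ht).1
    (intervalIntegral.intervalIntegrable_rpow' (a := 0) (b := t) ha)
  rw [← ofReal_integral_eq_lintegral_ofReal hi, ← intervalIntegral.integral_of_le ht,
    integral_rpow (Or.inl ha), Real.zero_rpow (by linarith), sub_zero]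
  filter_upwards [ae_restrict_mem measurableSet_Ioc] with r hr
  exact Real.rpow_nonneg hr.1.le _

theorem lintegral_Ioi_rpow {a t : ℝ} (ha : a < -1) (ht : 0 < t) :
    ∫⁻ r in Ioi t, ENNReal.ofReal (r ^ a) = ENNReal.ofReal (-t ^ (a + 1) / (a + 1)) := by
  rw [← ofReal_integral_eq_lintegral_ofReal (integrableOn_Ioi_rpow_of_lt ha ht),
    integral_Ioi_rpow_of_lt ha ht]
  filter_upwards [ae_restrict_mem measurableSet_Ioi] with r hr
  exact Real.rpow_nonneg (ht.trans hr).le _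

/-- The factor `min 1 (τ / r)`. -/
noncomputable def cutoff (τ r : ℝ) : ℝ≥0∞ := ENNReal.ofReal (min 1 (τ / r))

@[fun_prop]
theorem Measurable.cutoff {X : Type*} [MeasurableSpace X] {f g : X → ℝ} (hf : Measurable f)
    (hg : Measurable g) : Measurable fun x => cutoff (f x) (g x) := by
  unfold _root_.cutoff; fun_prop

theorem cutoff_le_one (τ r : ℝ) : cutoff τ r ≤ 1 :=
  ENNReal.ofReal_le_one.2 (min_le_left _ _)

theorem cutoff_mono {τ τ' r : ℝ} (hr : 0 < r) (h : τ ≤ τ') : cutoff τ r ≤ cutoff τ' r := by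
  unfold cutoff; gcongr

/-- The cutoff is `1` below `τ` and `τ / r` above it. Convergence at `0` needs `ε > 0`, and
convergence at infinity needs `ε < 1`. This and the next lemma are the two halves of the Schur test
in the scale variables. -/
theorem lintegral_rpow_mul_cutoff_left {ε τ : ℝ} (h0 : 0 < ε) (h1 : ε < 1) (hτ : 0 < τ) :
    ∫⁻ r in Ioi 0, ENNReal.ofReal (r ^ (ε - 1)) * cutoff τ r
      ≤ ENNReal.ofReal (1 / ε + 1 / (1 - ε)) * ENNReal.ofReal (τ ^ ε) := by
  rw [← Ioc_union_Ioi_eq_Ioi hτ.le]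
  refine (lintegral_union_le _ _ _).trans ?_
  have e1 : ∫⁻ r in Ioc 0 τ, ENNReal.ofReal (r ^ (ε - 1)) * cutoff τ r
      ≤ ENNReal.ofReal (τ ^ ε / ε) := by
    refine (lintegral_mono fun r => mul_le_of_le_one_right' (cutoff_le_one τ r)).trans_eq ?_
    rw [lintegral_Ioc_rpow (by linarith) hτ.le, sub_add_cancel]
  have e2 : ∫⁻ r in Ioi τ, ENNReal.ofReal (r ^ (ε - 1)) * cutoff τ r
      ≤ ENNReal.ofReal (τ ^ ε / (1 - ε)) := by
    have : ∫⁻ r in Ioi τ, ENNReal.ofReal (r ^ (ε - 1)) * cutoff τ r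
        ≤ ∫⁻ r in Ioi τ, ENNReal.ofReal τ * ENNReal.ofReal (r ^ (ε - 2)) := by
      refine setLIntegral_mono (by fun_prop) fun r hr => ?_
      have hr' : 0 < r := hτ.trans hr
      rw [cutoff, ← ENNReal.ofReal_mul (by positivity), ← ENNReal.ofReal_mul hτ.le]
      refine ENNReal.ofReal_le_ofReal ?_
      calc r ^ (ε - 1) * min 1 (τ / r) ≤ r ^ (ε - 1) * (τ / r) := by
            gcongr; exact min_le_right _ _
        _ = τ * r ^ (ε - 2) := by
            rw [show ε - 2 = (ε - 1) - 1 by ring, Real.rpow_sub_one hr'.ne' (ε - 1)]; ring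
    refine this.trans_eq ?_
    rw [lintegral_const_mul _ (by fun_prop), lintegral_Ioi_rpow (by linarith) hτ,
      ← ENNReal.ofReal_mul hτ.le]
    congr 1
    rw [show ε - 2 + 1 = ε - 1 by ring, Real.rpow_sub_one hτ.ne']
    have : 1 - ε ≠ 0 := by linarith
    have : ε - 1 ≠ 0 := by linarith
    field_simp
    ring
  refine (add_le_add e1 e2).trans_eq ?_
  have : 0 < 1 - ε := by linarith
  rw [← ENNReal.ofReal_add (by positivity) (by positivity), ← ENNReal.ofReal_mul (by positivity)]
  congr 1
  ring

theorem lintegral_rpow_mul_cutoff_right {η r : ℝ} (h0 : 0 < η) (h1 : η < 1) (hr : 0 < r) :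
    ∫⁻ τ in Ioi 0, ENNReal.ofReal (τ ^ (-η - 1)) * cutoff τ r
      ≤ ENNReal.ofReal (1 / η + 1 / (1 - η)) * ENNReal.ofReal (r ^ (-η)) := by
  rw [← Ioc_union_Ioi_eq_Ioi hr.le]
  refine (lintegral_union_le _ _ _).trans ?_
  have e1 : ∫⁻ τ in Ioi r, ENNReal.ofReal (τ ^ (-η - 1)) * cutoff τ r
      ≤ ENNReal.ofReal (r ^ (-η) / η) := by
    refine (lintegral_mono fun τ => mul_le_of_le_one_right' (cutoff_le_one τ r)).trans_eq ?_
    rw [lintegral_Ioi_rpow (by linarith) hr, sub_add_cancel, neg_div_neg_eq]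
  have e2 : ∫⁻ τ in Ioc 0 r, ENNReal.ofReal (τ ^ (-η - 1)) * cutoff τ r
      ≤ ENNReal.ofReal (r ^ (-η) / (1 - η)) := by
    have : ∫⁻ τ in Ioc 0 r, ENNReal.ofReal (τ ^ (-η - 1)) * cutoff τ r
        ≤ ∫⁻ τ in Ioc 0 r, ENNReal.ofReal r⁻¹ * ENNReal.ofReal (τ ^ (-η)) := by
      refine setLIntegral_mono (by fun_prop) fun τ hτ => ?_
      have hτ' : 0 < τ := hτ.1
      rw [cutoff, ← ENNReal.ofReal_mul (by positivity), ← ENNReal.ofReal_mul (by positivity)]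
      refine ENNReal.ofReal_le_ofReal ?_
      calc τ ^ (-η - 1) * min 1 (τ / r) ≤ τ ^ (-η - 1) * (τ / r) := by
            gcongr; exact min_le_right _ _
        _ = r⁻¹ * τ ^ (-η) := by
            rw [Real.rpow_sub_one hτ'.ne']; field_simp
    refine this.trans_eq ?_
    rw [lintegral_const_mul _ (by fun_prop), lintegral_Ioc_rpow (by linarith) hr.le,
      ← ENNReal.ofReal_mul (by positivity)]
    congr 1
    rw [Real.rpow_add_one hr.ne', neg_add_eq_sub]
    have : 1 - η ≠ 0 := by linarith
    field_simp
  refine (add_le_add e2 e1).trans_eq ?_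
  have : 0 < 1 - η := by linarith
  rw [← ENNReal.ofReal_add (by positivity) (by positivity), ← ENNReal.ofReal_mul (by positivity)]
  congr 1
  ring

end PowerIntegrals

/-! ### The measure on the cones and the weighted Cauchy–Schwarz estimate -/

section ConeMeasure

/-- The measure `r ^ (-b - 1) dr` on `(0, ∞)`. -/
noncomputable def scaleMeasure (b : ℝ) : Measure ℝ :=
  (volume.restrict (Ioi 0)).withDensity fun r => ENNReal.ofReal (r ^ (-b - 1))

instance (b : ℝ) : SFinite (scaleMeasure b) := by unfold scaleMeasure; infer_instance

theorem lintegral_scaleMeasure (b : ℝ) {f : ℝ → ℝ≥0∞} (hf : Measurable f) :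
    ∫⁻ r, f r ∂scaleMeasure b = ∫⁻ r in Ioi 0, ENNReal.ofReal (r ^ (-b - 1)) * f r := by
  rw [scaleMeasure, lintegral_withDensity_eq_lintegral_mul _ (by fun_prop) hf]
  rfl

theorem ae_scaleMeasure_pos (b : ℝ) : ∀ᵐ r ∂scaleMeasure b, 0 < r :=
  (withDensity_absolutelyContinuous _ _).ae_le (ae_restrict_mem measurableSet_Ioi)

variable {n : ℕ}

/-- The union of the cones `{(z, r) : |z - P| < r}` with vertices at the points `P` of `Γ`. -/
def coneSet (Γ : Set (EuclideanSpace ℝ (Fin n))) : Set (EuclideanSpace ℝ (Fin n) × ℝ) :=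
  {p | ∃ P ∈ Γ, dist p.1 P < p.2}

theorem measurableSet_coneSet (Γ : Set (EuclideanSpace ℝ (Fin n))) :
    MeasurableSet (coneSet Γ) := by
  have : coneSet Γ = ⋃ P ∈ Γ, {p : EuclideanSpace ℝ (Fin n) × ℝ | dist p.1 P < p.2} := by
    ext p; simp [coneSet]
  rw [this]
  exact (isOpen_biUnion fun P _ => isOpen_lt (by fun_prop) (by fun_prop)).measurableSet

/-- The measure `r ^ (-b - 1) dz dr` on the union of the cones with vertices in `Γ`. -/
noncomputable def coneMeasure (Γ : Set (EuclideanSpace ℝ (Fin n))) (b : ℝ) :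
    Measure (EuclideanSpace ℝ (Fin n) × ℝ) :=
  ((volume : Measure (EuclideanSpace ℝ (Fin n))).prod (scaleMeasure b)).restrict (coneSet Γ)

instance (Γ : Set (EuclideanSpace ℝ (Fin n))) (b : ℝ) : SFinite (coneMeasure Γ b) := by
  unfold coneMeasure; infer_instance

theorem coneMeasure_le (Γ : Set (EuclideanSpace ℝ (Fin n))) (b : ℝ) :
    coneMeasure Γ b ≤ (volume : Measure (EuclideanSpace ℝ (Fin n))).prod (scaleMeasure b) :=
  Measure.restrict_le_self

theorem ae_prod_scaleMeasure_pos (b : ℝ) :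
    ∀ᵐ p ∂(volume : Measure (EuclideanSpace ℝ (Fin n))).prod (scaleMeasure b), 0 < p.2 :=
  Measure.quasiMeasurePreserving_snd.ae (ae_scaleMeasure_pos b)

theorem ae_coneMeasure_pos (Γ : Set (EuclideanSpace ℝ (Fin n))) (b : ℝ) :
    ∀ᵐ p ∂coneMeasure Γ b, 0 < p.2 :=
  (Measure.absolutelyContinuous_of_le (coneMeasure_le Γ b)).ae_le (ae_prod_scaleMeasure_pos b)

open Classical in
/-- The indicator function of the cone with vertex `P`. -/
noncomputable def coneInd (P : EuclideanSpace ℝ (Fin n)) (p : EuclideanSpace ℝ (Fin n) × ℝ) :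
    ℝ≥0∞ :=
  if dist p.1 P < p.2 then 1 else 0

@[fun_prop]
theorem Measurable.coneInd {X : Type*} [MeasurableSpace X] {f : X → EuclideanSpace ℝ (Fin n)}
    {g : X → EuclideanSpace ℝ (Fin n) × ℝ} (hf : Measurable f) (hg : Measurable g) :
    Measurable fun x => coneInd (f x) (g x) := by
  classical
  unfold _root_.coneInd
  refine Measurable.ite (measurableSet_lt ?_ ?_) measurable_const measurable_const
  · fun_prop
  · fun_prop

theorem coneInd_of_lt {P : EuclideanSpace ℝ (Fin n)} {p : EuclideanSpace ℝ (Fin n) × ℝ}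
    (h : dist p.1 P < p.2) : coneInd P p = 1 := by
  rw [coneInd, if_pos h]

theorem coneInd_of_le {P : EuclideanSpace ℝ (Fin n)} {p : EuclideanSpace ℝ (Fin n) × ℝ}
    (h : p.2 ≤ dist p.1 P) : coneInd P p = 0 := by
  rw [coneInd, if_neg (not_lt.2 h)]

theorem coneInd_sq (P : EuclideanSpace ℝ (Fin n)) (p : EuclideanSpace ℝ (Fin n) × ℝ) :
    coneInd P p ^ 2 = coneInd P p := by
  rcases lt_or_ge (dist p.1 P) p.2 with h | h
  · simp [coneInd_of_lt h]
  · simp [coneInd_of_le h]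

theorem coneInd_eq_indicator_left (P : EuclideanSpace ℝ (Fin n)) (r : ℝ) :
    (fun z => coneInd P (z, r)) = (Metric.ball P r).indicator 1 := by
  classical
  ext z
  rw [indicator_apply]
  simp [coneInd]

theorem coneInd_eq_indicator_right (p : EuclideanSpace ℝ (Fin n) × ℝ) :
    (fun P => coneInd P p) = (Metric.ball p.1 p.2).indicator 1 := by
  classical
  ext P
  rw [indicator_apply]
  simp [coneInd, dist_comm]

theorem lintegral_prod_coneInd (b : ℝ) (P : EuclideanSpace ℝ (Fin n)) {f : ℝ → ℝ≥0∞}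
    (hf : Measurable f) :
    ∫⁻ p, f p.2 * coneInd P p
      ∂(volume : Measure (EuclideanSpace ℝ (Fin n))).prod (scaleMeasure b)
      = ∫⁻ r, f r * volume (Metric.ball P r) ∂scaleMeasure b := by
  rw [lintegral_prod_symm _ (by fun_prop)]
  refine lintegral_congr fun r => ?_
  dsimp only
  rw [lintegral_const_mul _ (by fun_prop),
    coneInd_eq_indicator_left, lintegral_indicator_one Metric.isOpen_ball.measurableSet]

theorem volume_ball_eq [NeZero n] (P : EuclideanSpace ℝ (Fin n)) {r : ℝ} (hr : 0 ≤ r) :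
    volume (Metric.ball P r) = volume (Metric.ball (0 : EuclideanSpace ℝ (Fin n)) 1) *
      ENNReal.ofReal (r ^ (n : ℝ)) := by
  rw [Measure.addHaar_ball _ _ hr, finrank_euclideanSpace_fin, mul_comm, Real.rpow_natCast]

/-- The basic weighted estimate for averages over cones. -/
theorem lintegral_sq_cone_le [NeZero n] (Γ : Set (EuclideanSpace ℝ (Fin n))) (b : ℝ)
    (m : Measure (EuclideanSpace ℝ (Fin n))) [SFinite m] {θ a a' κ : ℝ → ℝ≥0∞}
    (hθ : Measurable θ) (ha : Measurable a) (ha' : Measurable a')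
    (haa : ∀ r > 0, 1 ≤ a r * a' r)
    (hm : ∀ x, ∀ r > 0, m (Metric.ball x r) ≤ κ r)
    {G : EuclideanSpace ℝ (Fin n) × ℝ → ℝ≥0∞} (hG : Measurable G) :
    ∫⁻ P, (∫⁻ p, θ p.2 * coneInd P p * G p ∂coneMeasure Γ b) ^ 2 ∂m
      ≤ (volume (Metric.ball (0 : EuclideanSpace ℝ (Fin n)) 1) *
          ∫⁻ r, θ r * a r * ENNReal.ofReal (r ^ (n : ℝ)) ∂scaleMeasure b) *
        ∫⁻ p, θ p.2 * a' p.2 * κ p.2 * G p ^ 2 ∂coneMeasure Γ b := by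
  have hA : ∀ P : EuclideanSpace ℝ (Fin n), ∫⁻ p, θ p.2 * a p.2 * coneInd P p ∂coneMeasure Γ b
      ≤ volume (Metric.ball (0 : EuclideanSpace ℝ (Fin n)) 1) *
          ∫⁻ r, θ r * a r * ENNReal.ofReal (r ^ (n : ℝ)) ∂scaleMeasure b := by
    intro P
    refine (lintegral_mono' (coneMeasure_le Γ b) le_rfl).trans_eq ?_
    rw [lintegral_prod_coneInd b P (f := fun r => θ r * a r) (by fun_prop),
      ← lintegral_const_mul _ (by fun_prop)]
    refine lintegral_congr_ae ?_
    filter_upwards [ae_scaleMeasure_pos b] with r hr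
    rw [volume_ball_eq P hr.le]
    ring
  -- Cauchy–Schwarz with the weights `a` and `a'` bounds the square by a factor uniform in `P` times
  -- an integral over the cone. In the latter, Fubini turns the integral of `coneInd P (z, r)` in
  -- `P` into `m(B(z, r)) ≤ κ r`.
  calc ∫⁻ P, (∫⁻ p, θ p.2 * coneInd P p * G p ∂coneMeasure Γ b) ^ 2 ∂m
      ≤ ∫⁻ P, (volume (Metric.ball (0 : EuclideanSpace ℝ (Fin n)) 1) *
          ∫⁻ r, θ r * a r * ENNReal.ofReal (r ^ (n : ℝ)) ∂scaleMeasure b) *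
        (∫⁻ p, θ p.2 * a' p.2 * G p ^ 2 * coneInd P p ∂coneMeasure Γ b) ∂m := by
        refine lintegral_mono fun P => ?_
        refine (sq_lintegral_le_of_sq_le_mul (A := fun p => θ p.2 * a p.2 * coneInd P p)
          (B := fun p => θ p.2 * a' p.2 * G p ^ 2 * coneInd P p) ?_ ?_ ?_).trans
          (mul_le_mul_left (hA P) _)
        · fun_prop
        · fun_prop
        · filter_upwards [ae_coneMeasure_pos Γ b] with p hp
          calc (θ p.2 * coneInd P p * G p) ^ 2 = 1 * (θ p.2 * coneInd P p * G p) ^ 2 := by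
                rw [one_mul]
            _ ≤ (a p.2 * a' p.2) * (θ p.2 * coneInd P p * G p) ^ 2 := by
                gcongr; exact haa _ hp
            _ = _ := by ring
    _ = (volume (Metric.ball (0 : EuclideanSpace ℝ (Fin n)) 1) *
          ∫⁻ r, θ r * a r * ENNReal.ofReal (r ^ (n : ℝ)) ∂scaleMeasure b) *
        ∫⁻ P, (∫⁻ p, θ p.2 * a' p.2 * G p ^ 2 * coneInd P p ∂coneMeasure Γ b) ∂m := by
        refine lintegral_const_mul _ (Measurable.lintegral_prod_right' (f := fun q :
          EuclideanSpace ℝ (Fin n) × (EuclideanSpace ℝ (Fin n) × ℝ) =>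
            θ q.2.2 * a' q.2.2 * G q.2 ^ 2 * coneInd q.1 q.2) ?_)
        fun_prop
    _ ≤ _ := by
        refine mul_le_mul_right ?_ _
        rw [lintegral_lintegral_swap]
        · refine lintegral_mono_ae ?_
          filter_upwards [ae_coneMeasure_pos Γ b] with p hp
          rw [lintegral_const_mul _ (by fun_prop), coneInd_eq_indicator_right,
            lintegral_indicator_one Metric.isOpen_ball.measurableSet]
          calc _ ≤ θ p.2 * a' p.2 * G p ^ 2 * κ p.2 := by gcongr; exact hm _ _ hp
            _ = _ := by ring
        · refine Measurable.aemeasurable ?_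
          simp only [Function.uncurry_def]
          fun_prop

end ConeMeasure

/-! ### Square function estimates for upper regular measures -/

section ConeEstimates

variable {n : ℕ}

/-- The measure `m` satisfies `m(B(x, r)) ≤ A r ^ d` for a finite constant `A`. -/
def IsUpperRegular (m : Measure (EuclideanSpace ℝ (Fin n))) (d : ℝ) : Prop :=
  ∃ A : ℝ≥0∞, A ≠ ∞ ∧ ∀ x, ∀ r > 0, m (Metric.ball x r) ≤ A * ENNReal.ofReal (r ^ d)

/-- The power bound gives convergence at small scales, where `b < N + d`; the constant bound gives
it at large scales, where `N < b`. -/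
theorem lintegral_scaleMeasure_min_lt_top {b d : ℝ} {N : ℝ} (hb : N < b) (hd : b < N + d)
    {A M : ℝ≥0∞} (hA : A ≠ ∞) (hM : M ≠ ∞) :
    ∫⁻ r, min (A * ENNReal.ofReal (r ^ d)) M * ENNReal.ofReal (r ^ N) ∂scaleMeasure b < ∞ := by
  rw [lintegral_scaleMeasure _ (by fun_prop), ← Ioc_union_Ioi_eq_Ioi zero_le_one]
  refine (lintegral_union_le _ _ _).trans_lt (ENNReal.add_lt_top.2 ⟨?_, ?_⟩)
  · have : ∫⁻ r in Ioc (0 : ℝ) 1, ENNReal.ofReal (r ^ (-b - 1)) *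
        (min (A * ENNReal.ofReal (r ^ d)) M * ENNReal.ofReal (r ^ N)) ≤
        ∫⁻ r in Ioc (0 : ℝ) 1, A * ENNReal.ofReal (r ^ (-b - 1 + d + N)) := by
      refine setLIntegral_mono (by fun_prop) fun r hr => ?_
      have hr0 : 0 < r := hr.1
      rw [Real.rpow_add hr0, Real.rpow_add hr0, ENNReal.ofReal_mul (by positivity),
        ENNReal.ofReal_mul (by positivity)]
      calc _ ≤ ENNReal.ofReal (r ^ (-b - 1)) *
            (A * ENNReal.ofReal (r ^ d) * ENNReal.ofReal (r ^ N)) := by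
            gcongr; exact min_le_left _ _
        _ = _ := by ring
    refine this.trans_lt ?_
    rw [lintegral_const_mul _ (by fun_prop), lintegral_Ioc_rpow (by linarith) zero_le_one]
    exact ENNReal.mul_lt_top hA.lt_top ENNReal.ofReal_lt_top
  · have : ∫⁻ r in Ioi (1 : ℝ), ENNReal.ofReal (r ^ (-b - 1)) *
        (min (A * ENNReal.ofReal (r ^ d)) M * ENNReal.ofReal (r ^ N)) ≤
        ∫⁻ r in Ioi (1 : ℝ), M * ENNReal.ofReal (r ^ (-b - 1 + N)) := by
      refine setLIntegral_mono (by fun_prop) fun r hr => ?_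
      have hr0 : 0 < r := zero_lt_one.trans hr
      rw [Real.rpow_add hr0, ENNReal.ofReal_mul (by positivity)]
      calc _ ≤ ENNReal.ofReal (r ^ (-b - 1)) * (M * ENNReal.ofReal (r ^ N)) := by
            gcongr; exact min_le_right _ _
        _ = _ := by ring
    refine this.trans_lt ?_
    rw [lintegral_const_mul _ (by fun_prop), lintegral_Ioi_rpow (by linarith) zero_lt_one]
    exact ENNReal.mul_lt_top hM.lt_top ENNReal.ofReal_lt_top

theorem volume_unitBall_ne_top : volume (Metric.ball (0 : EuclideanSpace ℝ (Fin n)) 1) ≠ ∞ :=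
  Metric.isBounded_ball.measure_lt_top.ne

/-- Integrals over cones of a square integrable function are square integrable with respect to
finite upper regular measures. -/
theorem exists_lintegral_sq_coneInd_le [NeZero n] (Γ : Set (EuclideanSpace ℝ (Fin n))) {b d : ℝ}
    (hb : n < b) (hd : b < n + d) (m : Measure (EuclideanSpace ℝ (Fin n))) [IsFiniteMeasure m]
    (hm : IsUpperRegular m d) :
    ∃ C : ℝ≥0∞, C ≠ ∞ ∧ ∀ G : EuclideanSpace ℝ (Fin n) × ℝ → ℝ≥0∞, Measurable G →
      ∫⁻ P, (∫⁻ p, coneInd P p * G p ∂coneMeasure Γ b) ^ 2 ∂m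
        ≤ C * ∫⁻ p, G p ^ 2 ∂coneMeasure Γ b := by
  obtain ⟨A, hA, hm⟩ := hm
  -- The growth bound handles small scales and the total mass handles large ones. The added `1`s
  -- keep `κ` nonzero on `r > 0`, so that `κ` and its inverse can serve as the pair of weights.
  set κ : ℝ → ℝ≥0∞ := fun r => min ((A + 1) * ENNReal.ofReal (r ^ d)) (m univ + 1) with hκ
  have hκm : Measurable κ := by fun_prop
  have hκt : ∀ r, κ r ≠ ∞ := fun r =>
    ((min_le_right _ _).trans_lt (by finiteness)).ne
  have hκ0 : ∀ r > 0, κ r ≠ 0 := by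
    intro r hr h
    have h1 : 0 < r ^ d := Real.rpow_pos_of_pos hr d
    rcases min_eq_bot.1 h with h | h
    · simp [h1.not_ge] at h
    · simp at h
  have hmκ : ∀ x, ∀ r > 0, m (Metric.ball x r) ≤ κ r := fun x r hr =>
    le_min ((hm x r hr).trans (by gcongr; exact le_self_add))
      ((measure_mono (subset_univ _)).trans le_self_add)
  refine ⟨volume (Metric.ball (0 : EuclideanSpace ℝ (Fin n)) 1) *
    ∫⁻ r, κ r * ENNReal.ofReal (r ^ (n : ℝ)) ∂scaleMeasure b, ?_, fun G hG => ?_⟩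
  · exact ENNReal.mul_ne_top volume_unitBall_ne_top
      (lintegral_scaleMeasure_min_lt_top hb hd (by finiteness) (by finiteness)).ne
  · refine (le_of_eq ?_).trans ((lintegral_sq_cone_le Γ b m (θ := fun _ => 1) (a := κ)
      (a' := fun r => (κ r)⁻¹) (κ := κ) measurable_const hκm hκm.inv
      (fun r hr => (ENNReal.mul_inv_cancel (hκ0 r hr) (hκt r)).ge) hmκ hG).trans
      (mul_le_mul' (le_of_eq ?_) (lintegral_mono fun p => ?_)))
    · simp only [one_mul]
    · simp only [one_mul]
    · rw [one_mul]
      exact mul_le_of_le_one_left' (ENNReal.inv_mul_le_one _)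

/-- The integral of `G` over the cone with vertex `P`, cut off at the scale `τ`. -/
noncomputable def coneAvg (Γ : Set (EuclideanSpace ℝ (Fin n))) (b : ℝ)
    (G : EuclideanSpace ℝ (Fin n) × ℝ → ℝ≥0∞) (τ : ℝ) (P : EuclideanSpace ℝ (Fin n)) : ℝ≥0∞ :=
  ∫⁻ p, cutoff τ p.2 * coneInd P p * G p ∂coneMeasure Γ b

theorem measurable_coneAvg (Γ : Set (EuclideanSpace ℝ (Fin n))) (b : ℝ)
    {G : EuclideanSpace ℝ (Fin n) × ℝ → ℝ≥0∞} (hG : Measurable G) :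
    Measurable fun q : ℝ × EuclideanSpace ℝ (Fin n) => coneAvg Γ b G q.1 q.2 :=
  Measurable.lintegral_prod_right' (f := fun q : (ℝ × EuclideanSpace ℝ (Fin n)) ×
    (EuclideanSpace ℝ (Fin n) × ℝ) => cutoff q.1.1 q.2.2 * coneInd q.1.2 q.2 * G q.2)
    (by fun_prop)

theorem coneAvg_mono (Γ : Set (EuclideanSpace ℝ (Fin n))) (b : ℝ)
    (G : EuclideanSpace ℝ (Fin n) × ℝ → ℝ≥0∞) {τ τ' : ℝ} (h : τ ≤ τ')
    (P : EuclideanSpace ℝ (Fin n)) : coneAvg Γ b G τ P ≤ coneAvg Γ b G τ' P := by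
  refine lintegral_mono_ae ?_
  filter_upwards [ae_coneMeasure_pos Γ b] with p hp
  gcongr
  exact cutoff_mono hp h

/-- The available power of the scale is `γ`, and the weight splits it evenly: `τ ^ (γ / 2)` comes
out of the first Cauchy–Schwarz factor, and `r ^ (γ / 2)` with the cutoff is left in the second.
Keeping the cutoff there makes a later integration over `τ` converge; `0 < γ < 2` is what puts `γ /
2` in `(0, 1)`. -/
theorem exists_lintegral_sq_coneAvg_le [NeZero n] (Γ : Set (EuclideanSpace ℝ (Fin n))) {b d γ : ℝ}
    (hγ : γ = d + n - b) (h0 : 0 < γ) (h2 : γ < 2)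
    (m : Measure (EuclideanSpace ℝ (Fin n))) [SFinite m] (hm : IsUpperRegular m d) :
    ∃ C : ℝ≥0∞, C ≠ ∞ ∧ ∀ G : EuclideanSpace ℝ (Fin n) × ℝ → ℝ≥0∞, Measurable G → ∀ τ > 0,
      ∫⁻ P, coneAvg Γ b G τ P ^ 2 ∂m
        ≤ C * (ENNReal.ofReal (τ ^ (γ / 2)) * ∫⁻ p, cutoff τ p.2 *
          (ENNReal.ofReal (p.2 ^ (γ / 2)) * G p ^ 2) ∂coneMeasure Γ b) := by
  obtain ⟨A, hA, hm⟩ := hm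
  refine ⟨volume (Metric.ball (0 : EuclideanSpace ℝ (Fin n)) 1) *
    ENNReal.ofReal (1 / (γ / 2) + 1 / (1 - γ / 2)) * A, ?_, fun G hG τ hτ => ?_⟩
  · have := volume_unitBall_ne_top (n := n)
    finiteness
  · refine (lintegral_sq_cone_le Γ b m (θ := cutoff τ)
      -- Chosen so that `a r * r ^ n * r ^ (-b - 1) = r ^ (γ / 2 - 1)`, while `r ^ d / a r = r ^ (γ
      -- / 2)`.
      (a := fun r => ENNReal.ofReal (r ^ (γ / 2 + b - n)))
      (a' := fun r => ENNReal.ofReal (r ^ (-(γ / 2 + b - n))))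
      (κ := fun r => A * ENNReal.ofReal (r ^ d)) (by fun_prop) (by fun_prop) (by fun_prop)
      (fun r hr => ?_) hm hG).trans ?_
    · rw [← ENNReal.ofReal_mul (by positivity), ← Real.rpow_add hr, add_neg_cancel,
        Real.rpow_zero, ENNReal.ofReal_one]
    · have e1 : ∫⁻ r, cutoff τ r * ENNReal.ofReal (r ^ (γ / 2 + b - n)) *
          ENNReal.ofReal (r ^ (n : ℝ)) ∂scaleMeasure b
          ≤ ENNReal.ofReal (1 / (γ / 2) + 1 / (1 - γ / 2)) * ENNReal.ofReal (τ ^ (γ / 2)) := by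
        refine le_trans (le_of_eq ?_)
          (lintegral_rpow_mul_cutoff_left (by linarith) (by linarith) hτ)
        rw [lintegral_scaleMeasure _ (by fun_prop)]
        refine setLIntegral_congr_fun measurableSet_Ioi fun r hr => ?_
        have hr0 : 0 < r := hr
        rw [show γ / 2 - 1 = (-b - 1) + (γ / 2 + b - n) + n by ring, Real.rpow_add hr0,
          Real.rpow_add hr0, ENNReal.ofReal_mul (by positivity),
          ENNReal.ofReal_mul (by positivity)]
        ring
      have e2 : ∫⁻ p, cutoff τ p.2 * ENNReal.ofReal (p.2 ^ (-(γ / 2 + b - n))) *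
          (A * ENNReal.ofReal (p.2 ^ d)) * G p ^ 2 ∂coneMeasure Γ b
          = A * ∫⁻ p, cutoff τ p.2 *
          (ENNReal.ofReal (p.2 ^ (γ / 2)) * G p ^ 2) ∂coneMeasure Γ b := by
        rw [← lintegral_const_mul _ (by fun_prop)]
        refine lintegral_congr_ae ?_
        filter_upwards [ae_coneMeasure_pos Γ b] with p hp
        rw [show γ / 2 = -(γ / 2 + b - n) + d by rw [hγ]; ring, Real.rpow_add hp,
          ENNReal.ofReal_mul (by positivity), show -(γ / 2 + b - n) + d = γ / 2 by rw [hγ]; ring]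
        ring
      calc _ ≤ (volume (Metric.ball (0 : EuclideanSpace ℝ (Fin n)) 1) *
            (ENNReal.ofReal (1 / (γ / 2) + 1 / (1 - γ / 2)) * ENNReal.ofReal (τ ^ (γ / 2)))) *
            (A * ∫⁻ p, cutoff τ p.2 *
            (ENNReal.ofReal (p.2 ^ (γ / 2)) * G p ^ 2) ∂coneMeasure Γ b) := by
            rw [e2]; gcongr
        _ = _ := by ring

/-- Integrating in `y` over `B(P, τ)` yields `τ ^ d₂` and leaves the weight `τ ^ (-γ - 1)`. The `L²`
bound at scale `τ` contributes `τ ^ (γ / 2)`, and the integral over `τ` of the remaining power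
against the cutoff is a multiple of `r ^ (-(γ / 2))`, which cancels the factor `r ^ (γ / 2)`
exactly. -/
theorem exists_lintegral_coneAvg_le [NeZero n] (Γ : Set (EuclideanSpace ℝ (Fin n)))
    {b d₁ d₂ e : ℝ} (h0 : b < n + d₁) (h2 : n + d₁ < b + 2) (he : e = d₁ + d₂ + n - b)
    (m₁ m₂ : Measure (EuclideanSpace ℝ (Fin n))) [SFinite m₁] [SFinite m₂]
    (hm₁ : IsUpperRegular m₁ d₁) (hm₂ : IsUpperRegular m₂ d₂) :
    ∃ C : ℝ≥0∞, C ≠ ∞ ∧ ∀ G : EuclideanSpace ℝ (Fin n) × ℝ → ℝ≥0∞, Measurable G →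
      ∫⁻ P, ∫⁻ y, (∫⁻ τ in Ioi (0 : ℝ), ENNReal.ofReal (τ ^ (-e - 1)) *
        coneInd y (P, τ) * coneAvg Γ b G τ P ^ 2) ∂m₂ ∂m₁ ≤ C * ∫⁻ p, G p ^ 2 ∂coneMeasure Γ b := by
  set γ := d₁ + n - b with hγ
  obtain ⟨C, hC, hC'⟩ := exists_lintegral_sq_coneAvg_le Γ hγ (by linarith) (by linarith) m₁ hm₁
  obtain ⟨A, hA, hm₂⟩ := hm₂
  refine ⟨A * C * ENNReal.ofReal (1 / (γ / 2) + 1 / (1 - γ / 2)), by finiteness, fun G hG => ?_⟩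
  have hX := measurable_coneAvg Γ b hG
  have hX1 : ∀ P, Measurable fun τ => coneAvg Γ b G τ P := fun P =>
    hX.comp (measurable_id.prodMk measurable_const)
  calc ∫⁻ P, ∫⁻ y, (∫⁻ τ in Ioi (0 : ℝ), ENNReal.ofReal (τ ^ (-e - 1)) *
        coneInd y (P, τ) * coneAvg Γ b G τ P ^ 2) ∂m₂ ∂m₁
      ≤ ∫⁻ P, (∫⁻ τ in Ioi (0 : ℝ), A * ENNReal.ofReal (τ ^ (-γ - 1)) *
          coneAvg Γ b G τ P ^ 2) ∂m₁ := by
        refine lintegral_mono fun P => ?_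
        rw [lintegral_lintegral_swap]
        · refine setLIntegral_mono ?_ fun τ hτ => ?_
          · have := hX1 P
            fun_prop
          have hτ0 : 0 < τ := hτ
          calc ∫⁻ y, ENNReal.ofReal (τ ^ (-e - 1)) * coneInd y (P, τ) *
                coneAvg Γ b G τ P ^ 2 ∂m₂
              = ENNReal.ofReal (τ ^ (-e - 1)) * m₂ (Metric.ball P τ) *
                coneAvg Γ b G τ P ^ 2 := by
                rw [lintegral_mul_const _ (by fun_prop), lintegral_const_mul _ (by fun_prop),
                  coneInd_eq_indicator_right,
                  lintegral_indicator_one Metric.isOpen_ball.measurableSet]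
            _ ≤ ENNReal.ofReal (τ ^ (-e - 1)) * (A * ENNReal.ofReal (τ ^ d₂)) *
                coneAvg Γ b G τ P ^ 2 := by
                gcongr
                exact hm₂ _ _ hτ0
            _ = _ := by
                rw [show -γ - 1 = (-e - 1) + d₂ by rw [hγ, he]; ring, Real.rpow_add hτ0,
                  ENNReal.ofReal_mul (by positivity)]
                ring
        · refine Measurable.aemeasurable ?_
          have : Measurable fun q : EuclideanSpace ℝ (Fin n) × ℝ => coneAvg Γ b G q.2 P :=
            (hX1 P).comp measurable_snd
          simp only [Function.uncurry_def]
          fun_prop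
    _ = ∫⁻ τ in Ioi 0, A * ENNReal.ofReal (τ ^ (-γ - 1)) * ∫⁻ P, coneAvg Γ b G τ P ^ 2 ∂m₁ := by
        rw [lintegral_lintegral_swap]
        · refine lintegral_congr fun τ => ?_
          have : Measurable fun P => coneAvg Γ b G τ P :=
            hX.comp (measurable_const.prodMk measurable_id)
          rw [lintegral_const_mul _ (by fun_prop)]
        · refine Measurable.aemeasurable ?_
          have : Measurable fun q : EuclideanSpace ℝ (Fin n) × ℝ => coneAvg Γ b G q.2 q.1 :=
            hX.comp measurable_swap
          simp only [Function.uncurry_def]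
          fun_prop
    _ ≤ ∫⁻ τ in Ioi 0, ∫⁻ p, A * C * (ENNReal.ofReal (τ ^ (-(γ / 2) - 1)) * cutoff τ p.2) *
          (ENNReal.ofReal (p.2 ^ (γ / 2)) * G p ^ 2) ∂coneMeasure Γ b := by
        refine setLIntegral_mono ?_ fun τ hτ => ?_
        · exact Measurable.lintegral_prod_right' (f := fun q : ℝ × (EuclideanSpace ℝ (Fin n) × ℝ) =>
            A * C * (ENNReal.ofReal (q.1 ^ (-(γ / 2) - 1)) * cutoff q.1 q.2.2) *
              (ENNReal.ofReal (q.2.2 ^ (γ / 2)) * G q.2 ^ 2)) (by fun_prop)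
        · have hτ0 : 0 < τ := hτ
          refine (mul_le_mul_right (hC' G hG τ hτ) _).trans_eq ?_
          rw [show -(γ / 2) - 1 = (-γ - 1) + γ / 2 by ring, Real.rpow_add hτ0,
            ENNReal.ofReal_mul (by positivity)]
          rw [← lintegral_const_mul _ (by fun_prop), ← lintegral_const_mul _ (by fun_prop),
            ← lintegral_const_mul _ (by fun_prop)]
          refine lintegral_congr fun p => ?_
          ring
    _ = ∫⁻ p, A * C * (∫⁻ τ in Ioi 0, ENNReal.ofReal (τ ^ (-(γ / 2) - 1)) * cutoff τ p.2) *
          (ENNReal.ofReal (p.2 ^ (γ / 2)) * G p ^ 2) ∂coneMeasure Γ b := by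
        rw [lintegral_lintegral_swap]
        · refine lintegral_congr fun p => ?_
          rw [lintegral_mul_const _ (by fun_prop), lintegral_const_mul _ (by fun_prop)]
        · refine Measurable.aemeasurable ?_
          simp only [Function.uncurry_def]
          fun_prop
    _ ≤ ∫⁻ p, A * C * ENNReal.ofReal (1 / (γ / 2) + 1 / (1 - γ / 2)) * G p ^ 2
          ∂coneMeasure Γ b := by
        refine lintegral_mono_ae ?_
        filter_upwards [ae_coneMeasure_pos Γ b] with p hp
        calc _ ≤ A * C * (ENNReal.ofReal (1 / (γ / 2) + 1 / (1 - γ / 2)) *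
              ENNReal.ofReal (p.2 ^ (-(γ / 2)))) *
              (ENNReal.ofReal (p.2 ^ (γ / 2)) * G p ^ 2) := by
              gcongr
              exact lintegral_rpow_mul_cutoff_right (by linarith) (by linarith) hp
          _ = A * C * ENNReal.ofReal (1 / (γ / 2) + 1 / (1 - γ / 2)) *
              (ENNReal.ofReal (p.2 ^ (-(γ / 2))) * ENNReal.ofReal (p.2 ^ (γ / 2))) * G p ^ 2 := by
              ring
          _ = _ := by
              rw [← ENNReal.ofReal_mul (by positivity), ← Real.rpow_add hp, neg_add_cancel,
                Real.rpow_zero, ENNReal.ofReal_one, mul_one]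
    _ = _ := lintegral_const_mul _ (by fun_prop)

end ConeEstimates

/-! ### Tent functions, cone integrals and their fractional difference quotients -/

section ConeIntegral

variable {n : ℕ}

/-- The tent function `max 0 (1 - |z - P| / r)`, supported in the cone with vertex `P`. -/
noncomputable def tent (P : EuclideanSpace ℝ (Fin n)) (p : EuclideanSpace ℝ (Fin n) × ℝ) : ℝ :=
  max 0 (1 - dist p.1 P / p.2)

@[fun_prop]
theorem Measurable.tent {X : Type*} [MeasurableSpace X] {f : X → EuclideanSpace ℝ (Fin n)}
    {g : X → EuclideanSpace ℝ (Fin n) × ℝ} (hf : Measurable f) (hg : Measurable g) :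
    Measurable fun x => tent (f x) (g x) := by
  unfold _root_.tent
  fun_prop

theorem tent_nonneg (P : EuclideanSpace ℝ (Fin n)) (p : EuclideanSpace ℝ (Fin n) × ℝ) :
    0 ≤ tent P p := le_max_left _ _

theorem tent_eq_zero {P : EuclideanSpace ℝ (Fin n)} {p : EuclideanSpace ℝ (Fin n) × ℝ}
    (hp : 0 < p.2) (h : p.2 ≤ dist p.1 P) : tent P p = 0 := by
  have : 1 ≤ dist p.1 P / p.2 := (one_le_div hp).2 h
  exact max_eq_left (by linarith)

theorem tent_le_one {P : EuclideanSpace ℝ (Fin n)} {p : EuclideanSpace ℝ (Fin n) × ℝ}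
    (hp : 0 < p.2) : tent P p ≤ 1 := by
  have : 0 ≤ dist p.1 P / p.2 := by positivity
  exact max_le zero_le_one (by linarith)

theorem enorm_tent_le {P : EuclideanSpace ℝ (Fin n)} {p : EuclideanSpace ℝ (Fin n) × ℝ}
    (hp : 0 < p.2) : ‖tent P p‖ₑ ≤ coneInd P p := by
  rcases lt_or_ge (dist p.1 P) p.2 with h | h
  · rw [coneInd_of_lt h, Real.enorm_of_nonneg (tent_nonneg P p)]
    exact ENNReal.ofReal_le_one.2 (tent_le_one hp)
  · simp [tent_eq_zero hp h]

theorem abs_tent_sub_le {P Q : EuclideanSpace ℝ (Fin n)} {p : EuclideanSpace ℝ (Fin n) × ℝ}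
    (hp : 0 < p.2) : |tent P p - tent Q p| ≤ min 1 (dist P Q / p.2) := by
  refine le_min ?_ ?_
  · rw [abs_le]
    constructor <;> linarith [tent_nonneg P p, tent_nonneg Q p, tent_le_one (P := P) hp,
      tent_le_one (P := Q) hp]
  · refine (abs_max_sub_max_le_max _ _ _ _).trans ?_
    rw [sub_self, abs_zero]
    refine max_le (by positivity) ?_
    rw [show 1 - dist p.1 P / p.2 - (1 - dist p.1 Q / p.2) = (dist p.1 Q - dist p.1 P) / p.2 by
      ring, abs_div, abs_of_pos hp]
    gcongr
    rw [dist_comm p.1 Q, dist_comm p.1 P, dist_comm P Q]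
    exact abs_dist_sub_le _ _ _

/-- A tent at scale `r` takes values in `[0, 1]` and is `1 / r`-Lipschitz in its vertex; the
difference vanishes outside the union of the two cones. -/
theorem enorm_tent_sub_le {P Q : EuclideanSpace ℝ (Fin n)} {p : EuclideanSpace ℝ (Fin n) × ℝ}
    (hp : 0 < p.2) :
    ‖tent P p - tent Q p‖ₑ ≤ cutoff (dist P Q) p.2 * coneInd P p +
      cutoff (dist P Q) p.2 * coneInd Q p := by
  have h : ‖tent P p - tent Q p‖ₑ ≤ cutoff (dist P Q) p.2 := by
    rw [← ofReal_norm]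
    exact ENNReal.ofReal_le_ofReal (abs_tent_sub_le hp)
  rcases lt_or_ge (dist p.1 P) p.2 with h1 | h1
  · rw [coneInd_of_lt h1, mul_one]
    exact h.trans le_self_add
  · rcases lt_or_ge (dist p.1 Q) p.2 with h2 | h2
    · rw [coneInd_of_lt h2, mul_one]
      exact h.trans le_add_self
    · simp [tent_eq_zero hp h1, tent_eq_zero hp h2]

/-- The integral of `g` against the tent functions. -/
noncomputable def coneIntegral (Γ : Set (EuclideanSpace ℝ (Fin n))) (b : ℝ)
    (g : EuclideanSpace ℝ (Fin n) × ℝ → ℝ) (P : EuclideanSpace ℝ (Fin n)) : ℝ :=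
  ∫ p, tent P p * g p ∂coneMeasure Γ b

theorem measurable_coneIntegral (Γ : Set (EuclideanSpace ℝ (Fin n))) (b : ℝ)
    {g : EuclideanSpace ℝ (Fin n) × ℝ → ℝ} (hg : Measurable g) :
    Measurable (coneIntegral Γ b g) := by
  have : Measurable fun q : EuclideanSpace ℝ (Fin n) × (EuclideanSpace ℝ (Fin n) × ℝ) =>
    tent q.1 q.2 * g q.2 := by fun_prop
  exact this.stronglyMeasurable.integral_prod_right.measurable

theorem lintegral_enorm_tent_mul_le (Γ : Set (EuclideanSpace ℝ (Fin n))) (b : ℝ)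
    (g : EuclideanSpace ℝ (Fin n) × ℝ → ℝ) (P : EuclideanSpace ℝ (Fin n)) :
    ∫⁻ p, ‖tent P p * g p‖ₑ ∂coneMeasure Γ b ≤ ∫⁻ p, coneInd P p * ‖g p‖ₑ ∂coneMeasure Γ b := by
  refine lintegral_mono_ae ?_
  filter_upwards [ae_coneMeasure_pos Γ b] with p hp
  rw [enorm_mul]
  gcongr
  exact enorm_tent_le hp

theorem enorm_coneIntegral_le (Γ : Set (EuclideanSpace ℝ (Fin n))) (b : ℝ)
    (g : EuclideanSpace ℝ (Fin n) × ℝ → ℝ) (P : EuclideanSpace ℝ (Fin n)) :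
    ‖coneIntegral Γ b g P‖ₑ ≤ ∫⁻ p, coneInd P p * ‖g p‖ₑ ∂coneMeasure Γ b :=
  (enorm_integral_le_lintegral_enorm _).trans (lintegral_enorm_tent_mul_le Γ b g P)

/-- The square of the cone integral of `|g|` has finite integral with respect to `m`, so it is
finite almost everywhere. Linearity of cone integrals is therefore available only at almost every
vertex. -/
theorem ae_integrable_tent_mul [NeZero n] (Γ : Set (EuclideanSpace ℝ (Fin n))) {b d : ℝ}
    (hb : n < b) (hd : b < n + d) (m : Measure (EuclideanSpace ℝ (Fin n))) [IsFiniteMeasure m]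
    (hm : IsUpperRegular m d) {g : EuclideanSpace ℝ (Fin n) × ℝ → ℝ} (hg : Measurable g)
    (hg2 : ∫⁻ p, ‖g p‖ₑ ^ 2 ∂coneMeasure Γ b ≠ ∞) :
    ∀ᵐ P ∂m, Integrable (fun p => tent P p * g p) (coneMeasure Γ b) := by
  obtain ⟨C, hC, h⟩ := exists_lintegral_sq_coneInd_le Γ hb hd m hm
  have h1 := (h (fun p => ‖g p‖ₑ) hg.enorm).trans_lt (ENNReal.mul_lt_top hC.lt_top hg2.lt_top)
  have h2 : Measurable fun P => ∫⁻ p, coneInd P p * ‖g p‖ₑ ∂coneMeasure Γ b :=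
    Measurable.lintegral_prod_right' (f := fun q : EuclideanSpace ℝ (Fin n) ×
      (EuclideanSpace ℝ (Fin n) × ℝ) => coneInd q.1 q.2 * ‖g q.2‖ₑ) (by fun_prop)
  filter_upwards [ae_lt_top (h2.pow_const 2) h1.ne] with P hP
  refine ⟨by fun_prop, (lintegral_enorm_tent_mul_le Γ b g P).trans_lt ?_⟩
  by_contra h3
  rw [not_lt, top_le_iff] at h3
  simp [h3] at hP

theorem isUpperRegular_volume [NeZero n] :
    IsUpperRegular (volume : Measure (EuclideanSpace ℝ (Fin n))) n :=
  ⟨_, volume_unitBall_ne_top, fun x _ hr => (volume_ball_eq x hr.le).le⟩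

theorem IsUpperRegular.mono {m m' : Measure (EuclideanSpace ℝ (Fin n))} {d : ℝ}
    (hm : IsUpperRegular m d) (h : m' ≤ m) : IsUpperRegular m' d := by
  obtain ⟨A, hA, hm⟩ := hm
  exact ⟨A, hA, fun x r hr => (h _).trans (hm x r hr)⟩

/-- Lebesgue measure is infinite, so the statement for finite measures is applied on an exhaustion
by balls. -/
theorem ae_volume_integrable_tent_mul [NeZero n] (Γ : Set (EuclideanSpace ℝ (Fin n))) {b : ℝ}
    (hb : n < b) (hd : b < n + n) {g : EuclideanSpace ℝ (Fin n) × ℝ → ℝ} (hg : Measurable g)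
    (hg2 : ∫⁻ p, ‖g p‖ₑ ^ 2 ∂coneMeasure Γ b ≠ ∞) :
    ∀ᵐ P, Integrable (fun p => tent P p * g p) (coneMeasure Γ b) := by
  have h : ∀ N : ℕ, ∀ᵐ P, P ∈ Metric.ball (0 : EuclideanSpace ℝ (Fin n)) N →
      Integrable (fun p => tent P p * g p) (coneMeasure Γ b) := fun N => by
    have : IsFiniteMeasure ((volume : Measure (EuclideanSpace ℝ (Fin n))).restrict
        (Metric.ball 0 (N : ℝ))) :=
      isFiniteMeasure_restrict.2 Metric.isBounded_ball.measure_lt_top.ne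
    exact (ae_restrict_iff' Metric.isOpen_ball.measurableSet).1 (ae_integrable_tent_mul Γ hb hd _
      (isUpperRegular_volume.mono Measure.restrict_le_self) hg hg2)
  filter_upwards [ae_all_iff.2 h] with P hP
  obtain ⟨N, hN⟩ := exists_nat_gt (dist P 0)
  exact hP N hN

theorem integrableOn_coneIntegral_ball [NeZero n] (Γ : Set (EuclideanSpace ℝ (Fin n))) {b : ℝ}
    (hb : n < b) (hd : b < n + n) {g : EuclideanSpace ℝ (Fin n) × ℝ → ℝ} (hg : Measurable g)
    (hg2 : ∫⁻ p, ‖g p‖ₑ ^ 2 ∂coneMeasure Γ b ≠ ∞) (x : EuclideanSpace ℝ (Fin n)) (R : ℝ) :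
    IntegrableOn (coneIntegral Γ b g) (Metric.ball x R) := by
  have : IsFiniteMeasure ((volume : Measure (EuclideanSpace ℝ (Fin n))).restrict
      (Metric.ball x R)) :=
    isFiniteMeasure_restrict.2 Metric.isBounded_ball.measure_lt_top.ne
  obtain ⟨C, hC, h⟩ := exists_lintegral_sq_coneInd_le Γ hb hd _
    (isUpperRegular_volume.mono (Measure.restrict_le_self (s := Metric.ball x R)))
  refine ⟨(measurable_coneIntegral Γ b hg).aestronglyMeasurable, ?_⟩
  have h1 : ∀ z : ℝ≥0∞, z ≤ 1 + z ^ 2 := fun z => by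
    rcases le_total z 1 with hz | hz
    · exact hz.trans le_self_add
    · exact (le_self_pow hz two_ne_zero).trans le_add_self
  calc ∫⁻ y in Metric.ball x R, ‖coneIntegral Γ b g y‖ₑ
      ≤ ∫⁻ y in Metric.ball x R, (1 + (∫⁻ p, coneInd y p * ‖g p‖ₑ ∂coneMeasure Γ b) ^ 2) :=
        lintegral_mono fun y => (enorm_coneIntegral_le Γ b g y).trans (h1 _)
    _ < ∞ := by
        rw [lintegral_add_left measurable_const, lintegral_one]
        exact ENNReal.add_lt_top.2 ⟨measure_lt_top _ _,
          (h _ hg.enorm).trans_lt (ENNReal.mul_lt_top hC.lt_top hg2.lt_top)⟩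

theorem enorm_coneIntegral_sub_le (Γ : Set (EuclideanSpace ℝ (Fin n))) (b : ℝ)
    {g : EuclideanSpace ℝ (Fin n) × ℝ → ℝ} (hg : Measurable g) {P Q : EuclideanSpace ℝ (Fin n)}
    (hP : Integrable (fun p => tent P p * g p) (coneMeasure Γ b))
    (hQ : Integrable (fun p => tent Q p * g p) (coneMeasure Γ b)) :
    ‖coneIntegral Γ b g P - coneIntegral Γ b g Q‖ₑ ≤
      coneAvg Γ b (fun p => ‖g p‖ₑ) (dist P Q) P + coneAvg Γ b (fun p => ‖g p‖ₑ) (dist P Q) Q := by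
  rw [coneIntegral, coneIntegral, ← integral_sub hP hQ, coneAvg, coneAvg,
    ← lintegral_add_left (by fun_prop)]
  refine (enorm_integral_le_lintegral_enorm _).trans (lintegral_mono_ae ?_)
  filter_upwards [ae_coneMeasure_pos Γ b] with p hp
  rw [← sub_mul, enorm_mul, ← add_mul]
  gcongr
  exact enorm_tent_sub_le hp

theorem ofReal_rpow_neg_eq_lintegral {δ e : ℝ} (hδ : 0 < δ) (he : 0 < e) :
    ENNReal.ofReal (δ ^ (-e)) =
      ENNReal.ofReal e * ∫⁻ τ in Ioi δ, ENNReal.ofReal (τ ^ (-e - 1)) := by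
  rw [lintegral_Ioi_rpow (by linarith) hδ, ← ENNReal.ofReal_mul he.le, sub_add_cancel,
    neg_div_neg_eq, mul_div_cancel₀ _ he.ne']

/-- The averages of `coneAvg` over the scales larger than the distance of two points. -/
noncomputable def coneTail (Γ : Set (EuclideanSpace ℝ (Fin n))) (b e : ℝ)
    (G : EuclideanSpace ℝ (Fin n) × ℝ → ℝ≥0∞)
    (q : EuclideanSpace ℝ (Fin n) × EuclideanSpace ℝ (Fin n)) : ℝ≥0∞ :=
  ∫⁻ τ in Ioi 0, ENNReal.ofReal (τ ^ (-e - 1)) * coneInd q.2 (q.1, τ) * coneAvg Γ b G τ q.1 ^ 2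

theorem measurable_coneTail (Γ : Set (EuclideanSpace ℝ (Fin n))) (b e : ℝ)
    {G : EuclideanSpace ℝ (Fin n) × ℝ → ℝ≥0∞} (hG : Measurable G) :
    Measurable (coneTail Γ b e G) := by
  refine Measurable.lintegral_prod_right' (f := fun q : (EuclideanSpace ℝ (Fin n) ×
    EuclideanSpace ℝ (Fin n)) × ℝ => ENNReal.ofReal (q.2 ^ (-e - 1)) *
      coneInd q.1.2 (q.1.1, q.2) * coneAvg Γ b G q.2 q.1.1 ^ 2) ?_
  have : Measurable fun q : (EuclideanSpace ℝ (Fin n) × EuclideanSpace ℝ (Fin n)) × ℝ =>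
      coneAvg Γ b G q.2 q.1.1 :=
    (measurable_coneAvg Γ b hG).comp
      (g := fun q : ℝ × EuclideanSpace ℝ (Fin n) => coneAvg Γ b G q.1 q.2)
      (f := fun q : (EuclideanSpace ℝ (Fin n) × EuclideanSpace ℝ (Fin n)) × ℝ => (q.2, q.1.1))
      (by fun_prop)
  fun_prop

/-- Writing `|P - Q| ^ (-e)` as an integral of `τ ^ (-e - 1)` over `τ > |P - Q|`, and enlarging the
cutoff scale from `|P - Q|` to `τ`, decouples the two points: in each term one point is the vertex
and the other enters only through `|P - Q| < τ`. -/
theorem ofReal_sq_coneIntegral_sub_div_le (Γ : Set (EuclideanSpace ℝ (Fin n))) (b : ℝ) {e : ℝ}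
    (he : 0 < e) {g : EuclideanSpace ℝ (Fin n) × ℝ → ℝ} (hg : Measurable g)
    {P Q : EuclideanSpace ℝ (Fin n)}
    (hP : Integrable (fun p => tent P p * g p) (coneMeasure Γ b))
    (hQ : Integrable (fun p => tent Q p * g p) (coneMeasure Γ b)) :
    ENNReal.ofReal (|coneIntegral Γ b g P - coneIntegral Γ b g Q| ^ 2 / ‖P - Q‖ ^ e) ≤
      (ENNReal.ofReal e * 4) * (coneTail Γ b e (fun p => ‖g p‖ₑ) (P, Q) +
        coneTail Γ b e (fun p => ‖g p‖ₑ) (Q, P)) := by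
  rcases eq_or_ne P Q with rfl | hPQ
  · simp
  have hδ : 0 < dist P Q := dist_pos.2 hPQ
  have hX : ∀ P, Measurable fun τ => coneAvg Γ b (fun p => ‖g p‖ₑ) τ P := fun P =>
    (measurable_coneAvg Γ b hg.enorm).comp (measurable_id.prodMk measurable_const)
  have h1 := enorm_coneIntegral_sub_le Γ b hg hP hQ
  set D := |coneIntegral Γ b g P - coneIntegral Γ b g Q| with hD
  have h2 : ENNReal.ofReal (D ^ 2 / ‖P - Q‖ ^ e) =
      ENNReal.ofReal e * ∫⁻ τ in Ioi (dist P Q), ENNReal.ofReal (τ ^ (-e - 1)) *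
        ENNReal.ofReal D ^ 2 := by
    rw [lintegral_mul_const _ (by fun_prop), ← mul_assoc, ← ofReal_rpow_neg_eq_lintegral hδ he,
      ← ENNReal.ofReal_pow (abs_nonneg _), ← ENNReal.ofReal_mul (by positivity),
      Real.rpow_neg hδ.le, dist_eq_norm]
    congr 1
    ring
  have h3 : ∀ x y z : ℝ≥0∞, z ≤ x + y → z ^ 2 ≤ 4 * (x ^ 2 + y ^ 2) := fun x y z h => by
    have h4 : x + y ≤ 2 * max x y := by
      rw [two_mul]; exact add_le_add (le_max_left _ _) (le_max_right _ _)
    calc z ^ 2 ≤ (2 * max x y) ^ 2 := pow_le_pow_left' (h.trans h4) 2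
      _ = 4 * max x y ^ 2 := by ring
      _ ≤ _ := by
        gcongr
        rcases max_choice x y with h | h <;> rw [h]
        · exact le_self_add
        · exact le_add_self
  have hDe : ENNReal.ofReal D = ‖coneIntegral Γ b g P - coneIntegral Γ b g Q‖ₑ := by
    rw [← ofReal_norm, Real.norm_eq_abs]
  unfold coneTail
  rw [h2, mul_assoc]
  refine mul_le_mul_right ?_ _
  rw [← lintegral_add_left (by have := hX P; fun_prop),
    ← lintegral_const_mul _ (by have := hX P; have := hX Q; fun_prop)]
  refine (setLIntegral_mono ?_ fun τ hτ => ?_).trans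
    (lintegral_mono_set (Ioi_subset_Ioi hδ.le))
  · have := hX P
    have := hX Q
    fun_prop
  have hτ' : dist P Q < τ := hτ
  rw [coneInd_of_lt (by exact hτ'), coneInd_of_lt (by rw [dist_comm]; exact hτ'), mul_one,
    ← mul_add, mul_left_comm]
  gcongr
  rw [hDe]
  exact h3 _ _ _ (h1.trans (add_le_add (coneAvg_mono Γ b _ hτ'.le P)
    (coneAvg_mono Γ b _ hτ'.le Q)))

/-- The fractional difference quotients of a cone integral, with respect to a pair of upper regular
measures. -/
theorem exists_lintegral_sq_coneIntegral_sub_le [NeZero n] (Γ : Set (EuclideanSpace ℝ (Fin n)))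
    {b d₁ d₂ e : ℝ} (h1 : b < n + d₁) (h1' : n + d₁ < b + 2) (h2 : b < n + d₂)
    (h2' : n + d₂ < b + 2) (he : e = d₁ + d₂ + n - b) (he0 : 0 < e)
    (m₁ m₂ : Measure (EuclideanSpace ℝ (Fin n))) [SFinite m₁] [SFinite m₂]
    (hm₁ : IsUpperRegular m₁ d₁) (hm₂ : IsUpperRegular m₂ d₂) :
    ∃ C : ℝ≥0∞, C ≠ ∞ ∧ ∀ g : EuclideanSpace ℝ (Fin n) × ℝ → ℝ, Measurable g →
      (∀ᵐ P ∂m₁, Integrable (fun p => tent P p * g p) (coneMeasure Γ b)) →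
      (∀ᵐ P ∂m₂, Integrable (fun p => tent P p * g p) (coneMeasure Γ b)) →
      ∫⁻ P, ∫⁻ Q, ENNReal.ofReal (|coneIntegral Γ b g P - coneIntegral Γ b g Q| ^ 2 /
        ‖P - Q‖ ^ e) ∂m₂ ∂m₁ ≤ C * ∫⁻ p, ‖g p‖ₑ ^ 2 ∂coneMeasure Γ b := by
  obtain ⟨C₁, hC₁, hC₁'⟩ := exists_lintegral_coneAvg_le Γ h1 h1' he m₁ m₂ hm₁ hm₂
  obtain ⟨C₂, hC₂, hC₂'⟩ := exists_lintegral_coneAvg_le Γ h2 h2'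
    (show e = d₂ + d₁ + n - b by rw [he]; ring) m₂ m₁ hm₂ hm₁
  refine ⟨ENNReal.ofReal e * 4 * (C₁ + C₂), by finiteness, fun g hg hg₁ hg₂ => ?_⟩
  have hm := measurable_coneTail Γ b e hg.enorm
  have hms : Measurable fun q : EuclideanSpace ℝ (Fin n) × EuclideanSpace ℝ (Fin n) =>
      coneTail Γ b e (fun p => ‖g p‖ₑ) (q.2, q.1) := hm.comp measurable_swap
  have hm1 : ∀ P, Measurable fun Q => coneTail Γ b e (fun p => ‖g p‖ₑ) (P, Q) := fun P =>
    hm.comp measurable_prodMk_left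
  have hm2 : ∀ P, Measurable fun Q => coneTail Γ b e (fun p => ‖g p‖ₑ) (Q, P) := fun P =>
    hm.comp measurable_prodMk_right
  calc ∫⁻ P, ∫⁻ Q, ENNReal.ofReal (|coneIntegral Γ b g P - coneIntegral Γ b g Q| ^ 2 /
        ‖P - Q‖ ^ e) ∂m₂ ∂m₁
      ≤ ∫⁻ P, ∫⁻ Q, (ENNReal.ofReal e * 4) * (coneTail Γ b e (fun p => ‖g p‖ₑ) (P, Q) +
          coneTail Γ b e (fun p => ‖g p‖ₑ) (Q, P)) ∂m₂ ∂m₁ := by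
        refine lintegral_mono_ae ?_
        filter_upwards [hg₁] with P hP
        refine lintegral_mono_ae ?_
        filter_upwards [hg₂] with Q hQ
        exact ofReal_sq_coneIntegral_sub_div_le Γ b he0 hg hP hQ
    _ = (ENNReal.ofReal e * 4) *
          (∫⁻ P, ∫⁻ Q, coneTail Γ b e (fun p => ‖g p‖ₑ) (P, Q) ∂m₂ ∂m₁ +
          ∫⁻ P, ∫⁻ Q, coneTail Γ b e (fun p => ‖g p‖ₑ) (Q, P) ∂m₂ ∂m₁) := by
        have k1 : Measurable fun P => ∫⁻ Q, coneTail Γ b e (fun p => ‖g p‖ₑ) (P, Q) ∂m₂ :=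
          hm.lintegral_prod_right'
        have k2 : Measurable fun P => ∫⁻ Q, coneTail Γ b e (fun p => ‖g p‖ₑ) (Q, P) ∂m₂ :=
          hms.lintegral_prod_right'
        rw [← lintegral_add_left k1, ← lintegral_const_mul _ (by fun_prop)]
        refine lintegral_congr fun P => ?_
        have k3 := hm1 P
        have k4 := hm2 P
        rw [lintegral_const_mul _ (by fun_prop), lintegral_add_left k3]
    _ ≤ (ENNReal.ofReal e * 4) * (C₁ * ∫⁻ p, ‖g p‖ₑ ^ 2 ∂coneMeasure Γ b +
          C₂ * ∫⁻ p, ‖g p‖ₑ ^ 2 ∂coneMeasure Γ b) := by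
        gcongr
        · exact hC₁' _ hg.enorm
        -- In the second term the vertex is the `m₂` variable, so the estimate with the two measures
        -- interchanged applies.
        · rw [lintegral_lintegral_swap hms.aemeasurable]
          exact hC₂' _ hg.enorm
    _ = _ := by ring

end ConeIntegral

/-! ### Convergence of averages over balls -/

section Averages

variable {n : ℕ}

/-- If `∫ |u(P) - u(y)|² / |P - y| ^ (n + 2β) dy` is finite for some `0 < β`, then the averages of
`u` over the balls `B(P, r)` tend to `u(P)`. -/
theorem tendsto_average_of_lintegral_sq_lt_top [NeZero n] {u : EuclideanSpace ℝ (Fin n) → ℝ}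
    (hu : Measurable u) {P : EuclideanSpace ℝ (Fin n)} {β : ℝ} (hβ : 0 < β)
    (hi : ∀ r, IntegrableOn u (Metric.ball P r))
    (h : ∫⁻ y, ENNReal.ofReal (|u P - u y| ^ 2 / ‖P - y‖ ^ (n + 2 * β)) ≠ ∞) :
    Tendsto (fun r : ℝ => ⨍ y in Metric.ball P r, u y) (𝓝[>] 0) (𝓝 (u P)) := by
  set I := ∫⁻ y, ENNReal.ofReal (|u P - u y| ^ 2 / ‖P - y‖ ^ (n + 2 * β)) with hI
  set v := volume (Metric.ball (0 : EuclideanSpace ℝ (Fin n)) 1) with hv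
  have hvt : v ≠ ∞ := volume_unitBall_ne_top
  have hv0 : v ≠ 0 := (Metric.measure_ball_pos _ _ one_pos).ne'
  have key : ∀ r > 0, ‖(⨍ y in Metric.ball P r, u y) - u P‖ₑ ≤
      ENNReal.ofReal (r ^ β) * (1 + v⁻¹ * I) := by
    intro r hr
    have hB := volume_ball_eq P hr.le
    rw [← hv] at hB
    have hBt : volume (Metric.ball P r) ≠ ∞ := Metric.isBounded_ball.measure_lt_top.ne
    have hB0 : volume (Metric.ball P r) ≠ 0 := (Metric.measure_ball_pos _ _ hr).ne'
    have : IsFiniteMeasure ((volume : Measure (EuclideanSpace ℝ (Fin n))).restrict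
        (Metric.ball P r)) := isFiniteMeasure_restrict.2 hBt
    have : NeZero ((volume : Measure (EuclideanSpace ℝ (Fin n))).restrict
        (Metric.ball P r)) := ⟨by simpa [Measure.restrict_eq_zero] using hB0⟩
    have e1 : (⨍ y in Metric.ball P r, u y) - u P = ⨍ y in Metric.ball P r, (u y - u P) := by
      conv_lhs => rw [← average_const (volume.restrict (Metric.ball P r)) (u P)]
      rw [average_eq, average_eq, average_eq, integral_sub (hi r) (integrable_const _), smul_sub]
    have e2 : ‖⨍ y in Metric.ball P r, (u y - u P)‖ₑ ≤
        (volume (Metric.ball P r))⁻¹ * ∫⁻ y in Metric.ball P r, ‖u y - u P‖ₑ := by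
      rw [setAverage_eq, enorm_smul]
      gcongr
      · rw [Real.enorm_of_nonneg (by positivity), Measure.real,
          ← ENNReal.toReal_inv, ENNReal.ofReal_toReal (ENNReal.inv_ne_top.2 hB0)]
      · exact enorm_integral_le_lintegral_enorm _
    have e3 : ∫⁻ y in Metric.ball P r, ‖u y - u P‖ₑ ≤
        ENNReal.ofReal (r ^ β) * volume (Metric.ball P r) +
          ENNReal.ofReal (r ^ (n + β)) * I := by
      calc ∫⁻ y in Metric.ball P r, ‖u y - u P‖ₑ
          ≤ ∫⁻ y in Metric.ball P r, (ENNReal.ofReal (r ^ β) + ENNReal.ofReal (r ^ (n + β)) *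
              ENNReal.ofReal (|u P - u y| ^ 2 / ‖P - y‖ ^ (n + 2 * β))) := by
            refine setLIntegral_mono (by fun_prop) fun y hy => ?_
            rw [← ENNReal.ofReal_mul (by positivity), ← ENNReal.ofReal_add (by positivity)
              (by positivity), ← ofReal_norm, Real.norm_eq_abs, abs_sub_comm]
            refine ENNReal.ofReal_le_ofReal ?_
            rcases eq_or_ne P y with rfl | hPy
            · simp
              positivity
            have hδ : 0 < ‖P - y‖ := norm_pos_iff.2 (sub_ne_zero.2 hPy)
            have hδr : ‖P - y‖ ≤ r := by
              rw [← dist_eq_norm, dist_comm]; exact (Metric.mem_ball.1 hy).le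
            have hδp : ‖P - y‖ ^ (n + 2 * β) ≤ r ^ (n + 2 * β) :=
              Real.rpow_le_rpow hδ.le hδr (by positivity)
            set D := |u P - u y|
            have hη : 0 < r ^ β := Real.rpow_pos_of_pos hr β
            -- Either `D ≤ r ^ β` or `D ≤ D ^ 2 / r ^ β`. Then `|P - y| ≤ r` brings in the integrand
            -- of `I`, and after division by the volume of the ball both terms are of order `r ^ β`.
            calc D ≤ r ^ β + D ^ 2 / r ^ β := by
                  have : D ^ 2 / r ^ β * r ^ β = D ^ 2 := div_mul_cancel₀ _ hη.ne'
                  by_contra! hlt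
                  nlinarith [sq_nonneg (D - r ^ β), sq_nonneg D, abs_nonneg (u P - u y)]
              _ = r ^ β + r ^ (n + β) * (D ^ 2 / r ^ (n + 2 * β)) := by
                  rw [show (n : ℝ) + 2 * β = (n + β) + β by ring, Real.rpow_add hr (n + β) β]
                  have : r ^ (n + β) ≠ 0 := (Real.rpow_pos_of_pos hr _).ne'
                  field_simp
              _ ≤ _ := by gcongr
        _ = ENNReal.ofReal (r ^ β) * volume (Metric.ball P r) + ENNReal.ofReal (r ^ (n + β)) *
              ∫⁻ y in Metric.ball P r,
                ENNReal.ofReal (|u P - u y| ^ 2 / ‖P - y‖ ^ (n + 2 * β)) := by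
            rw [lintegral_add_left measurable_const, setLIntegral_const,
              lintegral_const_mul _ (by fun_prop)]
        _ ≤ _ := by
            gcongr
            exact setLIntegral_le_lintegral _ _
    rw [e1]
    refine (e2.trans (mul_le_mul_right e3 _)).trans_eq ?_
    have hrn : ENNReal.ofReal (r ^ (n : ℝ)) ≠ 0 := by
      have := Real.rpow_pos_of_pos hr n
      simpa using this
    rw [mul_add, mul_left_comm, ENNReal.inv_mul_cancel hB0 hBt, mul_one, mul_add, mul_one, hB,
      ENNReal.mul_inv (Or.inl hv0) (Or.inl hvt), Real.rpow_add hr,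
      ENNReal.ofReal_mul (by positivity)]
    calc _ = ENNReal.ofReal (r ^ β) + ENNReal.ofReal (r ^ β) * (v⁻¹ * I) *
          ((ENNReal.ofReal (r ^ (n : ℝ)))⁻¹ * ENNReal.ofReal (r ^ (n : ℝ))) := by ring
      _ = _ := by rw [ENNReal.inv_mul_cancel hrn ENNReal.ofReal_ne_top, mul_one]
  rw [tendsto_iff_edist_tendsto_0]
  have h0 : Tendsto (fun r : ℝ => ENNReal.ofReal (r ^ β) * (1 + v⁻¹ * I)) (𝓝[>] 0) (𝓝 0) := by
    have h1 : Tendsto (fun r : ℝ => ENNReal.ofReal (r ^ β)) (𝓝[>] 0) (𝓝 0) := by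
      have h2 : ContinuousAt (fun r : ℝ => ENNReal.ofReal (r ^ β)) 0 :=
        (ENNReal.continuous_ofReal.continuousAt).comp
          (Real.continuousAt_rpow_const _ _ (Or.inr hβ.le))
      have h3 := h2.tendsto
      simp only [Real.zero_rpow hβ.ne', ENNReal.ofReal_zero] at h3
      exact h3.mono_left nhdsWithin_le_nhds
    have hc : 1 + v⁻¹ * I ≠ ∞ := by
      have := ENNReal.inv_ne_top.2 hv0
      finiteness
    simpa using ENNReal.Tendsto.mul_const h1 (Or.inr hc)
  refine tendsto_of_tendsto_of_tendsto_of_le_of_le' tendsto_const_nhds h0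
    (Eventually.of_forall fun _ => zero_le) ?_
  filter_upwards [self_mem_nhdsWithin] with r hr
  rw [edist_eq_enorm_sub]
  exact key r hr

/-- Cone integrals of square integrable functions are continuous in the mean at almost every point,
with respect to an upper regular measure. -/
theorem ae_tendsto_average_coneIntegral [NeZero n] (Γ : Set (EuclideanSpace ℝ (Fin n)))
    {b d : ℝ} (hb : n < b) (hb2 : b < n + n) (hb3 : n + n < b + 2) (hd : b < n + d)
    (hd2 : n + d < b + 2) (m : Measure (EuclideanSpace ℝ (Fin n))) [IsFiniteMeasure m]
    (hm : IsUpperRegular m d) {g : EuclideanSpace ℝ (Fin n) × ℝ → ℝ} (hg : Measurable g)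
    (hg2 : ∫⁻ p, ‖g p‖ₑ ^ 2 ∂coneMeasure Γ b ≠ ∞) :
    ∀ᵐ P ∂m, Tendsto (fun r : ℝ => ⨍ y in Metric.ball P r, coneIntegral Γ b g y) (𝓝[>] 0)
      (𝓝 (coneIntegral Γ b g P)) := by
  have hU := measurable_coneIntegral Γ b hg
  -- With `d₁ = d` and `d₂ = n`, this makes `n + 2 * β` the exponent `d₁ + d₂ + n - b` of the
  -- two-measure estimate.
  set β := (d + n - b) / 2 with hβ
  have hβ0 : 0 < β := by rw [hβ]; linarith
  obtain ⟨C, hC, h⟩ := exists_lintegral_sq_coneIntegral_sub_le Γ hd hd2 hb2 hb3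
    (e := n + 2 * β) (by rw [hβ]; ring) (by positivity) m volume hm isUpperRegular_volume
  have h1 := (h g hg (ae_integrable_tent_mul Γ hb hd m hm hg hg2)
    (ae_volume_integrable_tent_mul Γ hb hb2 hg hg2)).trans_lt
      (ENNReal.mul_lt_top hC.lt_top hg2.lt_top)
  have h2 : Measurable fun P => ∫⁻ y, ENNReal.ofReal (|coneIntegral Γ b g P -
      coneIntegral Γ b g y| ^ 2 / ‖P - y‖ ^ (n + 2 * β)) :=
    Measurable.lintegral_prod_right' (f := fun q : EuclideanSpace ℝ (Fin n) ×
      EuclideanSpace ℝ (Fin n) => ENNReal.ofReal (|coneIntegral Γ b g q.1 -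
      coneIntegral Γ b g q.2| ^ 2 / ‖q.1 - q.2‖ ^ (n + 2 * β))) (by fun_prop)
  filter_upwards [ae_lt_top h2 h1.ne] with P hP
  exact tendsto_average_of_lintegral_sq_lt_top hU hβ0
    (fun r => integrableOn_coneIntegral_ball Γ hb hb2 hg hg2 P r) hP.ne

end Averages

/-! ### The Riesz kernel as a pairing of tent functions -/

section Composition

variable {n : ℕ}

theorem lintegral_comp_smul_addHaar {E : Type*} [NormedAddCommGroup E] [NormedSpace ℝ E]
    [MeasurableSpace E] [BorelSpace E] [FiniteDimensional ℝ E] (μ : Measure E)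
    [μ.IsAddHaarMeasure] {f : E → ℝ≥0∞} (hf : Measurable f) {k : ℝ} (hk : 0 < k) :
    ∫⁻ x, f x ∂μ = ENNReal.ofReal (k ^ Module.finrank ℝ E) * ∫⁻ x, f (k • x) ∂μ := by
  rw [← lintegral_map (g := fun x => k • x) hf (measurable_const_smul k),
    Measure.map_addHaar_smul μ hk.ne', lintegral_smul_measure, smul_eq_mul, ← mul_assoc,
    ← ENNReal.ofReal_mul (by positivity), abs_of_pos (by positivity),
    mul_inv_cancel₀ (by positivity), ENNReal.ofReal_one, one_mul]

theorem lintegral_Ioi_comp_mul {f : ℝ → ℝ≥0∞} (hf : Measurable f) {k : ℝ} (hk : 0 < k) :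
    ∫⁻ r in Ioi 0, f r = ENNReal.ofReal k * ∫⁻ r in Ioi 0, f (k * r) := by
  rw [← lintegral_indicator measurableSet_Ioi, ← lintegral_indicator measurableSet_Ioi,
    lintegral_comp_smul_addHaar volume (hf.indicator measurableSet_Ioi) hk, Module.finrank_self,
    pow_one]
  congr 2
  ext r
  simp only [indicator_apply, mem_Ioi, smul_eq_mul, mul_pos_iff_of_pos_left hk]

/-- The pairing of two tent functions. -/
noncomputable def tentPairing (b : ℝ) (x y : EuclideanSpace ℝ (Fin n)) : ℝ≥0∞ :=
  ∫⁻ p, ENNReal.ofReal (tent x p * tent y p)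
    ∂(volume : Measure (EuclideanSpace ℝ (Fin n))).prod (scaleMeasure b)

theorem tentPairing_eq (b : ℝ) (x y : EuclideanSpace ℝ (Fin n)) :
    tentPairing b x y = ∫⁻ r in Ioi 0, ENNReal.ofReal (r ^ (-b - 1)) *
      ∫⁻ z, ENNReal.ofReal (tent x (z, r) * tent y (z, r)) := by
  rw [tentPairing, lintegral_prod_symm _ (by fun_prop), lintegral_scaleMeasure]
  exact Measurable.lintegral_prod_left' (f := fun q : EuclideanSpace ℝ (Fin n) × ℝ =>
    ENNReal.ofReal (tent x q * tent y q)) (by fun_prop)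

theorem tent_similarity {k : ℝ} (hk : 0 < k) (x a z : EuclideanSpace ℝ (Fin n))
    (R : EuclideanSpace ℝ (Fin n) ≃ₗᵢ[ℝ] EuclideanSpace ℝ (Fin n)) (r : ℝ) :
    tent (x + k • R a) (x + k • R z, k * r) = tent a (z, r) := by
  simp only [tent, dist_add_left, dist_smul₀, R.dist_map, Real.norm_of_nonneg hk.le]
  rw [mul_div_mul_left _ _ hk.ne']

/-- Substituting `z ↦ x + k • R z` and `r ↦ k r` leaves the tents unchanged; the measure `r ^ (-b -
1) dz dr` contributes `k ^ n * k * k ^ (-b - 1)`. -/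
theorem tentPairing_similarity (b : ℝ) {k : ℝ} (hk : 0 < k) (x a a' : EuclideanSpace ℝ (Fin n))
    (R : EuclideanSpace ℝ (Fin n) ≃ₗᵢ[ℝ] EuclideanSpace ℝ (Fin n)) :
    tentPairing b (x + k • R a) (x + k • R a') =
      ENNReal.ofReal (k ^ (n - b)) * tentPairing b a a' := by
  have hin : ∀ r, ∫⁻ z, ENNReal.ofReal (tent (x + k • R a) (z, k * r) *
      tent (x + k • R a') (z, k * r)) = ENNReal.ofReal (k ^ (n : ℝ)) *
        ∫⁻ z, ENNReal.ofReal (tent a (z, r) * tent a' (z, r)) := fun r => by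
    rw [← lintegral_add_left_eq_self _ x,
      lintegral_comp_smul_addHaar volume (by fun_prop) hk, finrank_euclideanSpace_fin,
      Real.rpow_natCast, ← R.measurePreserving.lintegral_comp (by fun_prop)]
    simp only [tent_similarity hk]
  have hm : ∀ x y : EuclideanSpace ℝ (Fin n), Measurable fun r : ℝ =>
      ∫⁻ z, ENNReal.ofReal (tent x (z, r) * tent y (z, r)) := fun x y =>
    Measurable.lintegral_prod_left' (f := fun q : EuclideanSpace ℝ (Fin n) × ℝ =>
      ENNReal.ofReal (tent x q * tent y q)) (by fun_prop)
  rw [tentPairing_eq, tentPairing_eq, lintegral_Ioi_comp_mul (by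
    have := hm (x + k • R a) (x + k • R a')
    fun_prop) hk, ← lintegral_const_mul _ (by have := hm a a'; fun_prop),
    ← lintegral_const_mul _ (by
    have := (hm (x + k • R a) (x + k • R a')).comp (measurable_const_mul k)
    simp only [Function.comp_def] at this
    fun_prop)]
  refine setLIntegral_congr_fun measurableSet_Ioi fun r hr => ?_
  have hr0 : 0 < r := hr
  rw [hin, Real.mul_rpow hk.le hr0.le, ENNReal.ofReal_mul (by positivity),
    show (n : ℝ) - b = 1 + (-b - 1) + n by ring, Real.rpow_add hk, Real.rpow_add hk,
    Real.rpow_one, ENNReal.ofReal_mul (by positivity), ENNReal.ofReal_mul (by positivity)]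
  ring

theorem tentPairing_eq_rpow_mul [NeZero n] (b : ℝ) (e : EuclideanSpace ℝ (Fin n)) (he : ‖e‖ = 1)
    (x y : EuclideanSpace ℝ (Fin n)) (hxy : x ≠ y) :
    tentPairing b x y = ENNReal.ofReal (‖x - y‖ ^ (n - b)) * tentPairing b 0 e := by
  have hk : 0 < ‖x - y‖ := norm_pos_iff.2 (sub_ne_zero.2 hxy)
  have hw : ‖e‖ = ‖(‖x - y‖⁻¹ • (y - x))‖ := by
    rw [norm_smul, norm_inv, norm_norm, norm_sub_rev y x, inv_mul_cancel₀ hk.ne', he]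
  -- The reflection exchanging two unit vectors serves as the rotation: it carries `e` to the
  -- direction of `y - x`, so the similarity maps `0` to `x` and `e` to `y`.
  have h := tentPairing_similarity b hk x 0 e
    (ℝ ∙ (e - ‖x - y‖⁻¹ • (y - x)))ᗮ.reflection
  rw [Submodule.reflection_sub hw, map_zero, smul_zero, add_zero, smul_inv_smul₀ hk.ne',
    add_sub_cancel] at h
  exact h

theorem lintegral_indicator_mul_coneInd_lt_top [NeZero n] {b ρ : ℝ} (hb : n < b) (hρ : 0 < ρ)
    (P : EuclideanSpace ℝ (Fin n)) :
    ∫⁻ p, (Ioi ρ).indicator 1 p.2 * coneInd P p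
      ∂(volume : Measure (EuclideanSpace ℝ (Fin n))).prod (scaleMeasure b) < ∞ := by
  have hi : Measurable ((Ioi ρ).indicator (1 : ℝ → ℝ≥0∞)) :=
    measurable_one.indicator measurableSet_Ioi
  rw [lintegral_prod_coneInd b P hi]
  have h1 : ∫⁻ r, (Ioi ρ).indicator 1 r * volume (Metric.ball P r) ∂scaleMeasure b =
      ∫⁻ r, (Ioi ρ).indicator 1 r * (volume (Metric.ball (0 : EuclideanSpace ℝ (Fin n)) 1) *
      ENNReal.ofReal (r ^ (n : ℝ))) ∂scaleMeasure b := by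
    refine lintegral_congr_ae ?_
    filter_upwards [ae_scaleMeasure_pos b] with r hr
    rw [volume_ball_eq P hr.le]
  have h2 : ∀ r, ENNReal.ofReal (r ^ (-b - 1)) * ((Ioi ρ).indicator 1 r *
      (volume (Metric.ball (0 : EuclideanSpace ℝ (Fin n)) 1) * ENNReal.ofReal (r ^ (n : ℝ)))) =
      (Ioi ρ).indicator (fun r => volume (Metric.ball (0 : EuclideanSpace ℝ (Fin n)) 1) *
        ENNReal.ofReal (r ^ (-b - 1 + n))) r := by
    intro r
    by_cases hr : r ∈ Ioi ρ
    · have hr0 : 0 < r := hρ.trans hr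
      rw [indicator_of_mem hr, indicator_of_mem hr, Pi.one_apply, one_mul, Real.rpow_add hr0,
        ENNReal.ofReal_mul (by positivity)]
      ring
    · simp [indicator_of_notMem hr]
  rw [h1, lintegral_scaleMeasure _ (by fun_prop)]
  simp only [h2]
  refine (setLIntegral_le_lintegral _ _).trans_lt ?_
  rw [lintegral_indicator measurableSet_Ioi, lintegral_const_mul _ (by fun_prop),
    lintegral_Ioi_rpow (by linarith) hρ]
  exact ENNReal.mul_lt_top volume_unitBall_ne_top.lt_top ENNReal.ofReal_lt_top

/-- Two cones meet only at scales `r > |x - y| / 2`, and away from `r = 0` the cone has finite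
measure because `n < b`. -/
theorem tentPairing_ne_top [NeZero n] {b : ℝ} (hb : n < b) {x y : EuclideanSpace ℝ (Fin n)}
    (hxy : x ≠ y) : tentPairing b x y ≠ ∞ := by
  have hδ : 0 < dist x y := dist_pos.2 hxy
  refine ((lintegral_mono_ae ?_).trans_lt
    (lintegral_indicator_mul_coneInd_lt_top hb (half_pos hδ) x)).ne
  filter_upwards [ae_prod_scaleMeasure_pos b] with p hp
  rcases le_or_gt p.2 (dist p.1 x) with h1 | h1
  · simp [tent_eq_zero hp h1]
  rcases le_or_gt p.2 (dist p.1 y) with h2 | h2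
  · simp [tent_eq_zero hp h2]
  have h3 : dist x y / 2 < p.2 := by
    have := dist_triangle_left x y p.1
    linarith
  rw [indicator_of_mem (by exact h3), coneInd_of_lt h1, Pi.one_apply, one_mul]
  exact ENNReal.ofReal_le_one.2 (mul_le_one₀ (tent_le_one hp) (tent_nonneg _ _) (tent_le_one hp))

theorem tentPairing_zero_ne_zero [NeZero n] {b : ℝ} (hb : 0 < b) {e : EuclideanSpace ℝ (Fin n)}
    (he : ‖e‖ = 1) : tentPairing b 0 e ≠ 0 := by
  -- On `B(0, 1) × (4, ∞)` both vertices are within distance `2` of `z`, so each tent is at least `1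
  -- / 2`.
  have h : ENNReal.ofReal (1 / 4) * ((volume : Measure (EuclideanSpace ℝ (Fin n))).prod
      (scaleMeasure b)) (Metric.ball 0 1 ×ˢ Ioi 4) ≤ tentPairing b 0 e := by
    rw [← setLIntegral_const]
    refine (setLIntegral_mono (by fun_prop) fun p hp => ?_).trans (setLIntegral_le_lintegral _ _)
    have h1 : dist p.1 0 < 1 := hp.1
    have h2 : 4 < p.2 := hp.2
    have hp0 : 0 < p.2 := by linarith
    have h3 : dist p.1 e ≤ 2 := by
      have := dist_triangle p.1 0 e
      rw [dist_zero_left, he] at this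
      linarith
    have h4 : ∀ a : EuclideanSpace ℝ (Fin n), dist p.1 a ≤ 2 → 1 / 2 ≤ tent a p := fun a ha => by
      refine le_max_of_le_right ?_
      have : dist p.1 a / p.2 ≤ 1 / 2 := by
        rw [div_le_iff₀ hp0]
        linarith
      linarith
    refine ENNReal.ofReal_le_ofReal ?_
    nlinarith [h4 0 (by linarith), h4 e h3]
  refine (lt_of_lt_of_le (ENNReal.mul_pos (by simp) ?_) h).ne'
  rw [Measure.prod_prod]
  refine mul_ne_zero (Metric.measure_ball_pos _ _ one_pos).ne' ?_
  rw [← lintegral_indicator_one measurableSet_Ioi, lintegral_scaleMeasure _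
    (measurable_one.indicator measurableSet_Ioi)]
  have h5 : ENNReal.ofReal (4 ^ (-b) / b) ≤ ∫⁻ r in Ioi (0 : ℝ), ENNReal.ofReal (r ^ (-b - 1)) *
      (Ioi (4 : ℝ)).indicator 1 r := by
    refine le_trans (le_of_eq ?_) (lintegral_mono_set (Ioi_subset_Ioi (by norm_num : (0 : ℝ) ≤ 4)))
    have h6 := lintegral_Ioi_rpow (show -b - 1 < -1 by linarith) (show (0 : ℝ) < 4 by norm_num)
    rw [sub_add_cancel, neg_div_neg_eq] at h6
    rw [← h6]
    refine setLIntegral_congr_fun measurableSet_Ioi fun r hr => ?_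
    rw [indicator_of_mem hr, Pi.one_apply, mul_one]
  exact (lt_of_lt_of_le (ENNReal.ofReal_pos.2 (by positivity)) h5).ne'

/-- The composition formula: the tent functions represent the Riesz kernel `|x - P| ^ (n - b)`. -/
theorem exists_integral_tent_mul_tent_eq [NeZero n] {b : ℝ} (hb : n < b) :
    ∃ C : ℝ, 0 < C ∧ ∀ (Γ : Set (EuclideanSpace ℝ (Fin n))), ∀ P ∈ Γ, ∀ x, x ≠ P →
      ∫ p, tent P p * tent x p ∂coneMeasure Γ b = C * ‖x - P‖ ^ (n - b) := by
  have hb0 : 0 < b := (Nat.cast_nonneg n).trans_lt hb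
  set e : EuclideanSpace ℝ (Fin n) := EuclideanSpace.single 0 1 with he'
  have he : ‖e‖ = 1 := by simp [he']
  have he0 : (0 : EuclideanSpace ℝ (Fin n)) ≠ e := by
    intro h
    rw [← h, norm_zero] at he
    exact zero_ne_one he
  refine ⟨(tentPairing b 0 e).toReal, ENNReal.toReal_pos (tentPairing_zero_ne_zero hb0 he)
    (tentPairing_ne_top hb he0), fun Γ P hP x hx => ?_⟩
  rw [integral_eq_lintegral_of_nonneg_ae
    (Eventually.of_forall fun p => mul_nonneg (tent_nonneg _ _) (tent_nonneg _ _))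
    (Measurable.aestronglyMeasurable (by fun_prop))]
  -- Since `P ∈ Γ`, the tent at `P` vanishes off `coneSet Γ`, so restricting the measure costs
  -- nothing and the constant does not depend on `Γ`.
  have h1 : ∫⁻ p, ENNReal.ofReal (tent P p * tent x p) ∂coneMeasure Γ b = tentPairing b P x := by
    rw [coneMeasure, tentPairing, ← lintegral_indicator (measurableSet_coneSet Γ)]
    refine lintegral_congr_ae ?_
    filter_upwards [ae_prod_scaleMeasure_pos b] with p hp
    by_cases h : p ∈ coneSet Γ
    · rw [indicator_of_mem h]
    · rw [indicator_of_notMem h, tent_eq_zero hp (not_lt.1 fun hlt => h ⟨P, hP, hlt⟩), zero_mul,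
        ENNReal.ofReal_zero]
  rw [h1, tentPairing_eq_rpow_mul b e he P x hx.symm, ENNReal.toReal_mul,
    ENNReal.toReal_ofReal (by positivity), mul_comm, norm_sub_rev]

/-- This is what the restriction to `coneSet Γ` is for: a point of that set in the cone over `x`
satisfies `dist(x, Γ) < 2 r`, so the scale stays away from `0`. On the full half-space the integral
would diverge at `r = 0`, since `n < b`. -/
theorem lintegral_sq_tent_lt_top [NeZero n] {Γ : Set (EuclideanSpace ℝ (Fin n))}
    (hΓ : IsClosed Γ) {b : ℝ} (hb : n < b) {x : EuclideanSpace ℝ (Fin n)} (hx : x ∉ Γ) :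
    ∫⁻ p, ‖tent x p‖ₑ ^ 2 ∂coneMeasure Γ b < ∞ := by
  obtain ⟨ρ, hρ, hρΓ⟩ := Metric.isOpen_iff.1 hΓ.isOpen_compl x hx
  refine (le_trans ?_ (lintegral_mono' (coneMeasure_le Γ b) le_rfl)).trans_lt
    (lintegral_indicator_mul_coneInd_lt_top hb (half_pos hρ) x)
  refine lintegral_mono_ae ?_
  filter_upwards [ae_coneMeasure_pos Γ b, ae_restrict_mem (measurableSet_coneSet Γ)] with p hp hpΓ
  rcases le_or_gt p.2 (dist p.1 x) with h1 | h1
  · simp [tent_eq_zero hp h1]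
  obtain ⟨P, hP, hPp⟩ := hpΓ
  have h2 : ρ ≤ dist P x := by
    by_contra! h
    exact hρΓ h hP
  have h3 : ρ / 2 < p.2 := by
    have := dist_triangle_left P x p.1
    linarith
  rw [indicator_of_mem (by exact h3), Pi.one_apply, one_mul, ← coneInd_sq]
  gcongr
  exact enorm_tent_le hp

end Composition

/-! ### Upper regularity of the surface measure -/

section SurfaceMeasure

variable {n : ℕ}

/-- The part of a Lipschitz graph in a ball of radius `ρ` has measure at most `A ρ ^ (n - 1)`. -/
theorem exists_euclideanHausdorffMeasure_graph_le {e : EuclideanSpace ℝ (Fin n)} (he : ‖e‖ = 1)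
    {K : ℝ≥0} {g : EuclideanSpace ℝ (Fin n) → ℝ} (hg : LipschitzWith K g) :
    ∃ A : ℝ≥0∞, A ≠ ∞ ∧ ∀ x, ∀ ρ > 0,
      (μHE[n - 1] : Measure (EuclideanSpace ℝ (Fin n)))
        ({y | g (y - ⟪e, y⟫ • e) = ⟪e, y⟫} ∩ Metric.ball x ρ)
        ≤ A * ENNReal.ofReal (ρ ^ (n - 1)) := by
  have he0 : e ≠ 0 := by
    rintro rfl
    simp at he
  have hn : Module.finrank ℝ (ℝ ∙ e)ᗮ = n - 1 := by
    have h1 := (ℝ ∙ e).finrank_add_finrank_orthogonal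
    rw [finrank_span_singleton he0, finrank_euclideanSpace_fin] at h1
    omega
  have hmem : ∀ x : EuclideanSpace ℝ (Fin n), x - ⟪e, x⟫ • e ∈ (ℝ ∙ e)ᗮ := fun x => by
    rw [Submodule.mem_orthogonal_singleton_iff_inner_right, inner_sub_right, inner_smul_right,
      real_inner_self_eq_norm_sq, he]
    ring
  let G : (ℝ ∙ e)ᗮ → EuclideanSpace ℝ (Fin n) := fun y => y + g y • e
  have hG : LipschitzWith (1 + K) G := by
    refine LipschitzWith.add (LipschitzWith.subtype_val _) ?_
    refine LipschitzWith.of_dist_le_mul fun y z => ?_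
    rw [dist_eq_norm, ← sub_smul, norm_smul, he, mul_one, ← dist_eq_norm]
    exact hg.dist_le_mul y z
  -- Orthogonal projection does not increase distances, so the part of the graph in `B(x, ρ)` lies
  -- over the ball of radius `ρ` about the projection of `x`.
  have hsub : ∀ x ρ, {y | g (y - ⟪e, y⟫ • e) = ⟪e, y⟫} ∩ Metric.ball x ρ ⊆
      G '' Metric.closedBall ⟨x - ⟪e, x⟫ • e, hmem x⟩ ρ := by
    rintro x ρ y ⟨hyg, hy⟩
    refine ⟨⟨y - ⟪e, y⟫ • e, hmem y⟩, ?_, ?_⟩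
    · rw [Metric.mem_closedBall, Subtype.dist_eq, dist_eq_norm]
      rw [Metric.mem_ball, dist_eq_norm] at hy
      set w := y - x with hw
      have h1 : y - ⟪e, y⟫ • e - (x - ⟪e, x⟫ • e) = w - ⟪e, w⟫ • e := by
        rw [hw, inner_sub_right, sub_smul]
        abel
      have h2 : ‖w - ⟪e, w⟫ • e‖ ^ 2 = ‖w‖ ^ 2 - ⟪e, w⟫ ^ 2 := by
        rw [norm_sub_sq_real, inner_smul_right, norm_smul, he, real_inner_comm, mul_one,
          Real.norm_eq_abs, sq_abs]
        ring
      rw [h1]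
      refine (le_of_sq_le_sq ?_ (norm_nonneg _)).trans hy.le
      nlinarith [sq_nonneg ⟪e, w⟫]
    · have h : g (y - ⟪e, y⟫ • e) = ⟪e, y⟫ := hyg
      change y - ⟪e, y⟫ • e + g (y - ⟪e, y⟫ • e) • e = y
      rw [h]
      abel
  set V := (μH[((n - 1 : ℕ) : ℝ)] : Measure (ℝ ∙ e)ᗮ) (Metric.ball 0 1) with hV
  have hVt : V ≠ ∞ := by
    rw [hV, ← hn]
    exact Metric.isBounded_ball.measure_lt_top.ne
  have hball : ∀ (z : (ℝ ∙ e)ᗮ) (ρ : ℝ), 0 < ρ →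
      (μH[((n - 1 : ℕ) : ℝ)] : Measure (ℝ ∙ e)ᗮ) (Metric.closedBall z ρ) =
        ENNReal.ofReal (ρ ^ (n - 1)) * V := fun z ρ hρ => by
    rw [hV, ← hn, Measure.addHaar_closedBall _ _ hρ.le]
  refine ⟨(Measure.addHaarScalarFactor (volume : Measure (EuclideanSpace ℝ (Fin (n - 1))))
    μH[((n - 1 : ℕ) : ℝ)] : ℝ≥0∞) * (((1 + K : ℝ≥0) : ℝ≥0∞) ^ ((n - 1 : ℕ) : ℝ) * V),
    ENNReal.mul_ne_top ENNReal.coe_ne_top (ENNReal.mul_ne_top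
      (ENNReal.rpow_lt_top_of_nonneg (Nat.cast_nonneg _) ENNReal.coe_ne_top).ne hVt),
    fun x ρ hρ => (measure_mono (hsub x ρ)).trans ?_⟩
  rw [Measure.euclideanHausdorffMeasure_def, Measure.smul_apply, ENNReal.smul_def, smul_eq_mul]
  refine (mul_le_mul_right (hG.hausdorffMeasure_image_le (Nat.cast_nonneg _) _) _).trans_eq ?_
  rw [hball _ _ hρ]
  ring

namespace BoundedLipschitzDomain

/-- By compactness finitely many Lipschitz graphs cover the boundary, and the graph constants are
added. The bound holds for balls with arbitrary centre and radius. -/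
theorem isUpperRegular_surfaceMeasure [NeZero n] (Ω : BoundedLipschitzDomain n) :
    IsUpperRegular Ω.surfaceMeasure ((n : ℝ) - 1) := by
  have hloc : ∀ P ∈ Ω.boundary, ∃ r > (0 : ℝ), ∃ A : ℝ≥0∞, A ≠ ∞ ∧ ∀ x, ∀ ρ > 0,
      (μHE[n - 1] : Measure (EuclideanSpace ℝ (Fin n)))
        ((Ω.boundary ∩ Metric.ball P r) ∩ Metric.ball x ρ) ≤ A * ENNReal.ofReal (ρ ^ (n - 1)) := by
    intro P hP
    obtain ⟨r, hr, e, he, K, g, hg, h⟩ := Ω.lipschitz P hP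
    obtain ⟨A, hA, hA'⟩ := exists_euclideanHausdorffMeasure_graph_le he hg
    exact ⟨r, hr, A, hA, fun x ρ hρ => (measure_mono (inter_subset_inter_left _
      (boundary_inter_ball_subset_graph hg h))).trans (hA' x ρ hρ)⟩
  choose! r hr A hA hA' using hloc
  obtain ⟨t, htΓ, hcov⟩ := Ω.isCompact_boundary.elim_nhds_subcover (fun P => Metric.ball P (r P))
    fun P hP => Metric.ball_mem_nhds P (hr P hP)
  refine ⟨∑ P ∈ t, A P, (ENNReal.sum_lt_top.2 fun P hP => (hA P (htΓ P hP)).lt_top).ne,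
    fun x ρ hρ => ?_⟩
  have hn : ρ ^ ((n : ℝ) - 1) = ρ ^ (n - 1) := by
    rw [← Real.rpow_natCast, Nat.cast_sub NeZero.one_le, Nat.cast_one]
  rw [hn, surfaceMeasure, Measure.restrict_apply Metric.isOpen_ball.measurableSet, inter_comm,
    Finset.sum_mul]
  have hsub : Ω.boundary ∩ Metric.ball x ρ ⊆
      ⋃ P ∈ t, (Ω.boundary ∩ Metric.ball P (r P)) ∩ Metric.ball x ρ := by
    rintro y ⟨hy, hyρ⟩
    obtain ⟨P, hP, hyP⟩ := mem_iUnion₂.1 (hcov hy)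
    exact mem_iUnion₂.2 ⟨P, hP, ⟨hy, hyP⟩, hyρ⟩
  refine (measure_mono hsub).trans ((measure_biUnion_finset_le _ _).trans ?_)
  exact Finset.sum_le_sum fun P hP => hA' P (htΓ P hP) x ρ hρ

/-- A set of finite `(n - 1)`-dimensional Hausdorff measure is null in dimension `n`. -/
theorem volume_boundary [NeZero n] (Ω : BoundedLipschitzDomain n) : volume Ω.boundary = 0 := by
  have h1 : (μHE[n - 1] : Measure (EuclideanSpace ℝ (Fin n))) Ω.boundary ≠ ∞ := by
    have := measure_ne_top Ω.surfaceMeasure univ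
    rwa [surfaceMeasure, Measure.restrict_apply_univ] at this
  have hn : n - 1 < n := Nat.sub_lt (NeZero.pos n) one_pos
  rw [← EuclideanSpace.euclideanHausdorffMeasure_eq_volume]
  exact (Measure.euclideanHausdorffMeasure_zero_or_top hn _).resolve_right h1

end BoundedLipschitzDomain

end SurfaceMeasure

/-! ### The trace operator on the cones -/

section Trace

theorem Lp_two_lintegral_enorm_sq {X : Type*} [MeasurableSpace X] {μ : Measure X}
    (f : Lp ℝ 2 μ) : ∫⁻ x, ‖f x‖ₑ ^ 2 ∂μ = ENNReal.ofReal (‖f‖ ^ 2) := by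
  have h := eLpNorm_eq_lintegral_rpow_enorm_toReal (μ := μ) (f := f) (p := 2) (by simp) (by simp)
  simp only [ENNReal.toReal_ofNat, ENNReal.rpow_ofNat] at h
  rw [ENNReal.ofReal_pow (norm_nonneg _), ofReal_norm, Lp.enorm_def, h, ← ENNReal.rpow_natCast,
    ← ENNReal.rpow_mul]
  norm_num

namespace BoundedLipschitzDomain

variable {n : ℕ}

theorem Sobolev.toL2_mk {Ω : BoundedLipschitzDomain n} {α : ℝ} {f : EuclideanSpace ℝ (Fin n) → ℝ}
    (hf : Ω.MemSobolev α f) : Sobolev.toL2 (Sobolev.mk f hf) =ᵐ[Ω.surfaceMeasure] f :=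
  hf.1.coeFn_toLp

theorem Sobolev.sq_norm_mk {Ω : BoundedLipschitzDomain n} {α : ℝ}
    {f : EuclideanSpace ℝ (Fin n) → ℝ} (hf : Ω.MemSobolev α f) :
    ENNReal.ofReal (‖Sobolev.mk f hf‖ ^ 2) =
      ∫⁻ P, ‖f P‖ₑ ^ 2 ∂Ω.surfaceMeasure + Ω.gagliardo α f := by
  have h1 : ∫ P, |toL2 (Sobolev.mk f hf) P| ^ 2 ∂Ω.surfaceMeasure =
      (∫⁻ P, ‖f P‖ₑ ^ 2 ∂Ω.surfaceMeasure).toReal := by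
    have h0 : ∫ P, |toL2 (Sobolev.mk f hf) P| ^ 2 ∂Ω.surfaceMeasure =
        ∫ P, ‖f P‖ ^ 2 ∂Ω.surfaceMeasure := by
      refine integral_congr_ae ?_
      filter_upwards [toL2_mk hf] with P hP
      rw [hP, Real.norm_eq_abs]
    have hm : AEStronglyMeasurable (fun P => ‖f P‖ ^ 2) Ω.surfaceMeasure := hf.1.1.norm.pow 2
    rw [h0, integral_eq_lintegral_of_nonneg_ae (Eventually.of_forall fun P => sq_nonneg _) hm]
    congr 1
    refine lintegral_congr fun P => ?_
    rw [ENNReal.ofReal_pow (norm_nonneg _), ofReal_norm]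
  have h2 : ∫⁻ P, ‖f P‖ₑ ^ 2 ∂Ω.surfaceMeasure ≠ ∞ := by
    have h3 : ∫⁻ P, ‖f P‖ₑ ^ 2 ∂Ω.surfaceMeasure =
        ∫⁻ P, ‖hf.1.toLp f P‖ₑ ^ 2 ∂Ω.surfaceMeasure := by
      refine lintegral_congr_ae ?_
      filter_upwards [hf.1.coeFn_toLp] with P hP
      rw [hP]
    rw [h3, Lp_two_lintegral_enorm_sq]
    exact ENNReal.ofReal_ne_top
  rw [norm_def, Real.sq_sqrt (add_nonneg (integral_nonneg fun _ => by positivity)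
    ENNReal.toReal_nonneg), h1, Ω.gagliardo_congr α (toL2_mk hf), ENNReal.ofReal_add
    ENNReal.toReal_nonneg ENNReal.toReal_nonneg, ENNReal.ofReal_toReal h2,
    ENNReal.ofReal_toReal hf.2.ne]

/-- The trace estimate for cone integrals. -/
theorem exists_coneIntegral_sobolev_le [NeZero n] (Ω : BoundedLipschitzDomain n) {s : ℝ}
    (hs : 1 / 2 < s) (hs1 : s < 1) (hn : 2 * s < n) :
    ∃ C : ℝ≥0∞, C ≠ ∞ ∧ ∀ g : EuclideanSpace ℝ (Fin n) × ℝ → ℝ, Measurable g →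
      ∫⁻ p, ‖g p‖ₑ ^ 2 ∂coneMeasure Ω.boundary (2 * n - 2 * s) ≠ ∞ →
      ∫⁻ P, ‖coneIntegral Ω.boundary (2 * n - 2 * s) g P‖ₑ ^ 2 ∂Ω.surfaceMeasure +
        Ω.gagliardo (s - 1 / 2) (coneIntegral Ω.boundary (2 * n - 2 * s) g)
        ≤ C * ∫⁻ p, ‖g p‖ₑ ^ 2 ∂coneMeasure Ω.boundary (2 * n - 2 * s) := by
  have hσ := Ω.isUpperRegular_surfaceMeasure
  obtain ⟨C₁, hC₁, h₁⟩ := exists_lintegral_sq_coneInd_le Ω.boundary (b := 2 * n - 2 * s)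
    (by linarith) (by linarith) _ hσ
  -- With `d₁ = d₂ = n - 1`, the exponent `d₁ + d₂ + n - b` is `n - 2 + 2s`, the Gagliardo exponent
  -- for `α = s - 1 / 2`.
  obtain ⟨C₂, hC₂, h₂⟩ := exists_lintegral_sq_coneIntegral_sub_le Ω.boundary
    (b := 2 * n - 2 * s) (e := (n : ℝ) - 1 + 2 * (s - 1 / 2))
    (by linarith) (by linarith) (by linarith) (by linarith) (by ring) (by linarith) _ _ hσ hσ
  refine ⟨C₁ + C₂, by finiteness, fun g hg hg2 => ?_⟩
  have hi := ae_integrable_tent_mul Ω.boundary (by linarith) (by linarith) _ hσ hg hg2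
  rw [add_mul]
  refine add_le_add ((lintegral_mono fun P => ?_).trans (h₁ _ hg.enorm)) (h₂ g hg hi hi)
  gcongr
  exact enorm_coneIntegral_le _ _ _ _

theorem memSobolev_coneIntegral [NeZero n] (Ω : BoundedLipschitzDomain n) {s : ℝ}
    (hs : 1 / 2 < s) (hs1 : s < 1) (hn : 2 * s < n) {g : EuclideanSpace ℝ (Fin n) × ℝ → ℝ}
    (hg : Measurable g) (hg2 : ∫⁻ p, ‖g p‖ₑ ^ 2 ∂coneMeasure Ω.boundary (2 * n - 2 * s) ≠ ∞) :
    Ω.MemSobolev (s - 1 / 2) (coneIntegral Ω.boundary (2 * n - 2 * s) g) := by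
  obtain ⟨C, hC, h⟩ := Ω.exists_coneIntegral_sobolev_le hs hs1 hn
  have h1 := (h g hg hg2).trans_lt (ENNReal.mul_lt_top hC.lt_top hg2.lt_top)
  refine ⟨⟨(measurable_coneIntegral _ _ hg).aestronglyMeasurable, ?_⟩,
    (le_add_self.trans_lt h1)⟩
  rw [eLpNorm_lt_top_iff_lintegral_rpow_enorm_lt_top (by simp) (by simp)]
  simp only [ENNReal.toReal_ofNat, ENNReal.rpow_ofNat]
  exact le_self_add.trans_lt h1

theorem lintegral_enorm_sq_ne_top {X : Type*} [MeasurableSpace X] {μ : Measure X}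
    (f : Lp ℝ 2 μ) : ∫⁻ x, ‖f x‖ₑ ^ 2 ∂μ ≠ ∞ := by
  rw [Lp_two_lintegral_enorm_sq]
  exact ENNReal.ofReal_ne_top

/-- The trace operator, from square integrable functions on the cones to `H^{s - 1/2}(∂Ω)`. -/
theorem exists_coneTrace [NeZero n] (Ω : BoundedLipschitzDomain n) {s : ℝ}
    (hs : 1 / 2 < s) (hs1 : s < 1) (hn : 2 * s < n) :
    ∃ T : Lp ℝ 2 (coneMeasure Ω.boundary (2 * n - 2 * s)) →L[ℝ] Ω.Sobolev (s - 1 / 2),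
      ∀ g, T g = Sobolev.mk _ (Ω.memSobolev_coneIntegral hs hs1 hn
        (Lp.stronglyMeasurable g).measurable (lintegral_enorm_sq_ne_top g)) := by
  set b : ℝ := 2 * n - 2 * s with hb
  set ν := coneMeasure Ω.boundary b with hν
  obtain ⟨C, hC, h⟩ := Ω.exists_coneIntegral_sobolev_le hs hs1 hn
  have hi : ∀ g : Lp ℝ 2 ν, ∀ᵐ P ∂Ω.surfaceMeasure, Integrable (fun p => tent P p * g p) ν :=
    fun g => ae_integrable_tent_mul Ω.boundary (by linarith) (by linarith) _
      Ω.isUpperRegular_surfaceMeasure (Lp.stronglyMeasurable g).measurable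
      (lintegral_enorm_sq_ne_top g)
  let T₀ : Lp ℝ 2 ν →ₗ[ℝ] Ω.Sobolev (s - 1 / 2) :=
    { toFun := fun g => Sobolev.mk _ (Ω.memSobolev_coneIntegral hs hs1 hn
        (Lp.stronglyMeasurable g).measurable (lintegral_enorm_sq_ne_top g))
      map_add' := fun f g => by
        apply Sobolev.toL2_injective
        rw [map_add]
        refine Lp.ext ?_
        filter_upwards [hi f, hi g, Sobolev.toL2_mk (Ω.memSobolev_coneIntegral hs hs1 hn
          (Lp.stronglyMeasurable f).measurable (lintegral_enorm_sq_ne_top f)),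
          Sobolev.toL2_mk (Ω.memSobolev_coneIntegral hs hs1 hn
          (Lp.stronglyMeasurable g).measurable (lintegral_enorm_sq_ne_top g)),
          Sobolev.toL2_mk (Ω.memSobolev_coneIntegral hs hs1 hn
          (Lp.stronglyMeasurable (f + g)).measurable (lintegral_enorm_sq_ne_top (f + g))),
          Lp.coeFn_add (Sobolev.toL2 (Sobolev.mk _ (Ω.memSobolev_coneIntegral hs hs1 hn
          (Lp.stronglyMeasurable f).measurable (lintegral_enorm_sq_ne_top f))))
          (Sobolev.toL2 (Sobolev.mk _ (Ω.memSobolev_coneIntegral hs hs1 hn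
          (Lp.stronglyMeasurable g).measurable (lintegral_enorm_sq_ne_top g))))]
          with P h1 h2 h3 h4 h5 h6
        rw [h5, h6, Pi.add_apply, h3, h4, coneIntegral, coneIntegral, coneIntegral,
          ← integral_add h1 h2]
        refine integral_congr_ae ?_
        filter_upwards [Lp.coeFn_add f g] with p hp
        rw [hp, Pi.add_apply, mul_add]
      map_smul' := fun c g => by
        apply Sobolev.toL2_injective
        rw [map_smul, RingHom.id_apply]
        refine Lp.ext ?_
        filter_upwards [Sobolev.toL2_mk (Ω.memSobolev_coneIntegral hs hs1 hn
          (Lp.stronglyMeasurable g).measurable (lintegral_enorm_sq_ne_top g)),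
          Sobolev.toL2_mk (Ω.memSobolev_coneIntegral hs hs1 hn
          (Lp.stronglyMeasurable (c • g)).measurable (lintegral_enorm_sq_ne_top (c • g))),
          Lp.coeFn_smul c (Sobolev.toL2 (Sobolev.mk _ (Ω.memSobolev_coneIntegral hs hs1 hn
          (Lp.stronglyMeasurable g).measurable (lintegral_enorm_sq_ne_top g))))]
          with P h3 h5 h6
        rw [h5, h6, Pi.smul_apply, h3, coneIntegral, coneIntegral, ← integral_smul]
        refine integral_congr_ae ?_
        filter_upwards [Lp.coeFn_smul c g] with p hp
        rw [hp, Pi.smul_apply, smul_eq_mul, smul_eq_mul, mul_left_comm] }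
  -- The trace estimate bounds squared norms, hence the square root.
  refine ⟨T₀.mkContinuous (√C.toReal) fun g => ?_, fun g => rfl⟩
  have h1 := h g (Lp.stronglyMeasurable g).measurable (lintegral_enorm_sq_ne_top g)
  rw [Lp_two_lintegral_enorm_sq, ← Sobolev.sq_norm_mk (Ω.memSobolev_coneIntegral hs hs1 hn
    (Lp.stronglyMeasurable g).measurable (lintegral_enorm_sq_ne_top g)),
    ← ENNReal.ofReal_toReal hC, ← ENNReal.ofReal_mul ENNReal.toReal_nonneg,
    ENNReal.ofReal_le_ofReal_iff (by positivity)] at h1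
  rw [← Real.sqrt_sq (norm_nonneg g), ← Real.sqrt_mul ENNReal.toReal_nonneg]
  exact Real.le_sqrt_of_sq_le h1

end BoundedLipschitzDomain

end Trace

/-! ### The layer potential as a cone integral -/

section LayerPotential

namespace BoundedLipschitzDomain

variable {n : ℕ}

/-- For `x` off the boundary, the kernel `Γ(x - ·)` is a multiple of the trace of the tent function
at `x`. -/
theorem rieszKernel_eqOn_boundary [NeZero n] (Ω : BoundedLipschitzDomain n) {s : ℝ} {C : ℝ}
    (hC : 0 < C) (hC' : ∀ P ∈ Ω.boundary, ∀ x, x ≠ P →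
      ∫ p, tent P p * tent x p ∂coneMeasure Ω.boundary (2 * n - 2 * s) =
        C * ‖x - P‖ ^ ((n : ℝ) - (2 * n - 2 * s))) (c : ℝ)
    {x : EuclideanSpace ℝ (Fin n)} (hx : x ∉ Ω.boundary) {g : EuclideanSpace ℝ (Fin n) × ℝ → ℝ}
    (hg : g =ᵐ[coneMeasure Ω.boundary (2 * n - 2 * s)] tent x) :
    (c / C) • coneIntegral Ω.boundary (2 * n - 2 * s) g =ᵐ[Ω.surfaceMeasure]
      fun Q => rieszKernel c s (x - Q) := by
  have hm : ∀ᵐ P ∂Ω.surfaceMeasure, P ∈ Ω.boundary :=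
    ae_restrict_mem isClosed_frontier.measurableSet
  filter_upwards [hm] with P hP
  have h1 : coneIntegral Ω.boundary (2 * n - 2 * s) g P =
      C * ‖x - P‖ ^ ((n : ℝ) - (2 * n - 2 * s)) := by
    rw [← hC' P hP x (fun h => hx (h ▸ hP)), coneIntegral]
    refine integral_congr_ae ?_
    filter_upwards [hg] with p hp
    rw [hp]
  rw [Pi.smul_apply, h1, rieszKernel, smul_eq_mul,
    show (n : ℝ) - (2 * n - 2 * s) = -((n : ℝ) - 2 * s) by ring, Real.rpow_neg (norm_nonneg _)]
  field_simp

/-- Evaluating a cone integral at a point whose tent is in `L²` is a bounded functional. This turns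
the abstract pairing with `φ` into a function of `x` that also makes sense on `∂Ω`. -/
theorem coneIntegral_eq_inner (Γ : Set (EuclideanSpace ℝ (Fin n))) (b : ℝ)
    (h g : Lp ℝ 2 (coneMeasure Γ b)) {x : EuclideanSpace ℝ (Fin n)}
    (hg : g =ᵐ[coneMeasure Γ b] tent x) : ⟪h, g⟫ = coneIntegral Γ b h x := by
  rw [L2.inner_def, coneIntegral]
  refine integral_congr_ae ?_
  filter_upwards [hg] with p hp
  rw [hp]
  simp

/-- The boundary is Lebesgue null, so the values of `u` there affect neither local integrability nor
the averages, and the properties of the cone integral pass to `u`. -/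
theorem isRestriction_smul_coneIntegral [NeZero n] (Ω : BoundedLipschitzDomain n) {s : ℝ}
    (hs : 1 / 2 < s) (hs1 : s < 1) (hn : 2 * s < n) (a : ℝ)
    {g : EuclideanSpace ℝ (Fin n) × ℝ → ℝ} (hg : Measurable g)
    (hg2 : ∫⁻ p, ‖g p‖ₑ ^ 2 ∂coneMeasure Ω.boundary (2 * n - 2 * s) ≠ ∞)
    {u f : EuclideanSpace ℝ (Fin n) → ℝ}
    (hu : ∀ x ∉ Ω.boundary, u x = a * coneIntegral Ω.boundary (2 * n - 2 * s) g x)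
    (hf : ∀ᵐ P ∂Ω.surfaceMeasure, f P = a * coneIntegral Ω.boundary (2 * n - 2 * s) g P) :
    Ω.IsRestriction u f := by
  have hae : u =ᵐ[volume] fun x => a * coneIntegral Ω.boundary (2 * n - 2 * s) g x := by
    filter_upwards [measure_eq_zero_iff_ae_notMem.1 Ω.volume_boundary] with x hx using hu x hx
  refine ⟨fun x => ⟨Metric.ball x 1, Metric.ball_mem_nhds x one_pos, ?_⟩, ?_⟩
  · exact ((integrableOn_coneIntegral_ball Ω.boundary (by linarith) (by linarith) hg hg2 x
      1).const_mul a).congr (ae_restrict_of_ae hae.symm)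
  · filter_upwards [hf, ae_tendsto_average_coneIntegral Ω.boundary (b := 2 * n - 2 * s)
      (by linarith) (by linarith) (by linarith) (by linarith) (by linarith) _
      Ω.isUpperRegular_surfaceMeasure hg hg2] with P hP hlim
    rw [hP]
    refine (hlim.const_mul a).congr fun r => ?_
    rw [setAverage_eq, setAverage_eq, integral_congr_ae (ae_restrict_of_ae hae),
      integral_const_mul, smul_eq_mul, smul_eq_mul, mul_left_comm]

end BoundedLipschitzDomain

end LayerPotential

/-! ### The factorisation of the boundary operator -/

theorem mainTheorem5 {n : ℕ} (Ω : BoundedLipschitzDomain n) {s : ℝ} (hs : 1 / 2 < s) (hs1 : s < 1)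
    (hn : 2 * s < n) (c : ℝ) :
    (∀ x ∉ Ω.boundary, Ω.MemSobolev (s - 1 / 2) (fun Q => rieszKernel c s (x - Q))) ∧
    ∃ S : Ω.DualSobolev (s - 1 / 2) →L[ℝ] Ω.Sobolev (s - 1 / 2),
      ∀ φ : Ω.DualSobolev (s - 1 / 2),
        Ω.IsRestriction (Ω.layerPotential c s φ) (BoundedLipschitzDomain.Sobolev.toL2 (S φ)) := by
  have : NeZero n := ⟨by rintro rfl; norm_num at hn; linarith⟩
  obtain ⟨C, hC, hC'⟩ := exists_integral_tent_mul_tent_eq (n := n) (b := 2 * n - 2 * s)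
    (by linarith)
  obtain ⟨T, hT⟩ := Ω.exists_coneTrace hs hs1 hn
  have hcl : IsClosed Ω.boundary := isClosed_frontier
  have htent : ∀ x ∉ Ω.boundary,
      MemLp (tent x) 2 (coneMeasure Ω.boundary (2 * n - 2 * s)) := fun x hx => by
    refine ⟨Measurable.aestronglyMeasurable (by fun_prop), ?_⟩
    rw [eLpNorm_lt_top_iff_lintegral_rpow_enorm_lt_top (by simp) (by simp)]
    simp only [ENNReal.toReal_ofNat, ENNReal.rpow_ofNat]
    exact lintegral_sq_tent_lt_top hcl (by linarith) hx
  -- The kernel with pole `x` is in the range of `T`, which gives its Sobolev membership without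
  -- estimating its difference quotients directly.
  have hker : ∀ x (hx : x ∉ Ω.boundary),
      BoundedLipschitzDomain.Sobolev.toL2 ((c / C) • T ((htent x hx).toLp)) =ᵐ[Ω.surfaceMeasure]
        fun Q => rieszKernel c s (x - Q) := fun x hx => by
    refine EventuallyEq.trans ?_ (Ω.rieszKernel_eqOn_boundary hC (hC' Ω.boundary) c hx
      (htent x hx).coeFn_toLp)
    rw [map_smul, hT]
    filter_upwards [Lp.coeFn_smul (c / C) (BoundedLipschitzDomain.Sobolev.toL2
      (BoundedLipschitzDomain.Sobolev.mk _ (Ω.memSobolev_coneIntegral hs hs1 hn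
        (Lp.stronglyMeasurable (htent x hx).toLp).measurable
        (BoundedLipschitzDomain.lintegral_enorm_sq_ne_top (htent x hx).toLp)))),
      BoundedLipschitzDomain.Sobolev.toL2_mk (Ω.memSobolev_coneIntegral hs hs1 hn
        (Lp.stronglyMeasurable (htent x hx).toLp).measurable
        (BoundedLipschitzDomain.lintegral_enorm_sq_ne_top (htent x hx).toLp))] with P h1 h2
    rw [h1, Pi.smul_apply, Pi.smul_apply, h2]
  have hmem : ∀ x ∉ Ω.boundary, Ω.MemSobolev (s - 1 / 2) (fun Q => rieszKernel c s (x - Q)) :=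
    fun x hx => (BoundedLipschitzDomain.Sobolev.memSobolev _).congr (hker x hx)
  refine ⟨hmem, ?_⟩
  let J := InnerProductSpace.toDual ℝ (Lp ℝ 2 (coneMeasure Ω.boundary (2 * n - 2 * s)))
  let S₀ : Ω.DualSobolev (s - 1 / 2) →ₗ[ℝ] Ω.Sobolev (s - 1 / 2) :=
    -- The Riesz representative of `φ ∘ T` is `T*φ`, so this is `(c / C) T T*`.
    { toFun := fun φ => (c / C) • T (J.symm (φ.comp T))
      map_add' := fun φ ψ => by
        rw [ContinuousLinearMap.add_comp, map_add, map_add, smul_add]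
      map_smul' := fun a φ => by
        rw [ContinuousLinearMap.smul_comp, map_smulₛₗ, map_smul, RingHom.id_apply, smul_comm]
        rfl }
  refine ⟨S₀.mkContinuous (|c / C| * (‖T‖ * ‖T‖)) fun φ => ?_, fun φ => ?_⟩
  · calc ‖(c / C) • T (J.symm (φ.comp T))‖ = |c / C| * ‖T (J.symm (φ.comp T))‖ := by
          rw [norm_smul, Real.norm_eq_abs]
      _ ≤ |c / C| * (‖T‖ * (‖φ‖ * ‖T‖)) := by
          gcongr
          refine (T.le_opNorm _).trans ?_
          gcongr
          rw [LinearIsometryEquiv.norm_map]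
          exact φ.opNorm_comp_le T
      _ = _ := by ring
  · set h := J.symm (φ.comp T) with hh
    refine Ω.isRestriction_smul_coneIntegral hs hs1 hn (c / C)
      (Lp.stronglyMeasurable h).measurable
      (BoundedLipschitzDomain.lintegral_enorm_sq_ne_top h) (fun x hx => ?_) ?_
    -- Off the boundary, `φ (T (tent x)) = ⟪T*φ, tent x⟫`, which is the cone integral of `T*φ` at
    -- `x`.
    · have h1 : BoundedLipschitzDomain.Sobolev.mk _ (hmem x hx) =
          (c / C) • T ((htent x hx).toLp) :=
        BoundedLipschitzDomain.Sobolev.toL2_injective (Lp.ext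
          ((BoundedLipschitzDomain.Sobolev.toL2_mk _).trans (hker x hx).symm))
      rw [BoundedLipschitzDomain.layerPotential, dif_pos ⟨hx, hmem x hx⟩, h1, map_smul,
        smul_eq_mul]
      congr 1
      rw [← BoundedLipschitzDomain.coneIntegral_eq_inner Ω.boundary _ h _
        (htent x hx).coeFn_toLp, hh, InnerProductSpace.toDual_symm_apply]
      rfl
    · change ∀ᵐ P ∂Ω.surfaceMeasure, BoundedLipschitzDomain.Sobolev.toL2 ((c / C) • T h) P = _
      rw [map_smul, hT]
      filter_upwards [Lp.coeFn_smul (c / C) (BoundedLipschitzDomain.Sobolev.toL2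
        (BoundedLipschitzDomain.Sobolev.mk _ (Ω.memSobolev_coneIntegral hs hs1 hn
          (Lp.stronglyMeasurable h).measurable
          (BoundedLipschitzDomain.lintegral_enorm_sq_ne_top h)))),
        BoundedLipschitzDomain.Sobolev.toL2_mk (Ω.memSobolev_coneIntegral hs hs1 hn
          (Lp.stronglyMeasurable h).measurable
          (BoundedLipschitzDomain.lintegral_enorm_sq_ne_top h))] with P h1 h2
      rw [h1, Pi.smul_apply, h2, smul_eq_mul]
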